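/- Consider a discrete memoryless channel with finite input alphabet $\mathcal X$, finite output alphabet $\mathcal Y$ and transition probabilities $W(y|x)>0$ for all $x,y$; let $\lambda=\min_{x,y}W(y|x)$. For a probability distribution $\varphi$ on $\mathcal X$ let $\psi_\varphi(y)=\sum_x\varphi(x)W(y|x)$ and $I(\varphi,W)=\sum_{x,y}\varphi(x)W(y|x)\ln\frac{W(y|x)}{\psi_\varphi(y)}$. Put $C=\max_\varphi I(\varphi,W)$, $D=\max_{x,x'}D(W_x\|W_{x'})$ (Kullback–Leibler divergence, in nats) and, for $R\le C$, $$J(R)=\max\ \alpha D(\psi_{\varphi_1}\|W_{x_1})+(1-\alpha)D(\psi_{\varphi_2}\|W_{x_2}),$$ the maximum being over $\alpha\in[0,1]$, $x_1,x_2\in\mathcal X$ and distributions $\varphi_1,\varphi_2$ on $\mathcal X$ with $\alpha I(\varphi_1,W)+(1-\alpha)I(\varphi_2,W)\ge R$. Let $h(s)=-s\ln s-(1-s)\ln(1-s)$. A variable-length block code with feedback and finite message set $\mathcal M$ consists of a decoding time $\tau\in\{1,2,\dots\}\cup\{\infty\}$ that is a Markov time with respect to the channel outputs $Y_1,Y_2,\dots$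 and is finite with probability one, encoding maps that give the channel input at time $t+1$ as a function of the message and of $Y^t=(Y_1,\dots,Y_t)$, and a decoding rule that gives the decoded message $\hat M\in\mathcal M$ as a function of $Y^\tau$. The message $M$ is uniform on $\mathcal M$, and $E[\tau]=\infty$ is allowed, in which case $a/E[\tau]$ means $0$ for every real number $a$. Let $\ell\ge1$ and let the message set be $\mathcal M=\mathcal M_1\times\dots\times\mathcal M_\ell$ with finite non-empty $\mathcal M_j$ and $|\mathcal M_1|\ge2$. Put $P_e=\Pr[\hat M\ne M]$ and $P_e(i)=\Pr[(\hat M_1,\dots,\hat M_i)\ne(M_1,\dots,M_i)]$. Let $\delta>0$ satisfy $P_e+\delta+\frac{P_e}{\delta}\le\frac15$. Then $P_e(i)>0$ for every $i$ and, with $$R_i=\frac{\ln|\mathcal M_i|}{E[\tau]},\quad E_i=\frac{-\ln P_e(i)}{E[\tau]},\quad \epsilon_3=P_e+\delta+\frac{P_e}{\delta},\quad \epsilon_4=\frac{h(\epsilon_3)}{E[\tau]},\quad \epsilon_5=\frac{h(\epsilon_3)-\ln(\lambda\delta)}{E[\tau]},$$ there is a vector $\vec\eta=(\eta_1,\dots,\eta_\ell)$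 with $\eta_i\ge0$ for all $i$ and $\sum_{j=1}^{\ell}\eta_j\le1$ such that for all $i\in\{1,\dots,\ell\}$ $$(1-\epsilon_3)E_i-\epsilon_5\ \le\ \Bigl(1-\sum_{j=1}^{\ell}\eta_j\Bigr)D+\sum_{j=i+1}^{\ell}\eta_j\,J\!\left(\frac{(1-\epsilon_3)R_j}{\eta_j}\right),$$ $$(1-\epsilon_3)R_i-\epsilon_4\,\mathbf 1\{i=1\}\ \le\ C\,\eta_i,$$ where the term $\eta_jJ((1-\epsilon_3)R_j/\eta_j)$ is interpreted as $0$ when $\eta_j=0$ (for $j\ge2$ the second inequality then forces $R_j=0$). -/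

import Mathlib

open MeasureTheory
open scoped ENNReal

noncomputable section

namespace FeedbackUEP

/-- A discrete memoryless channel with input alphabet `X` and output alphabet `Y`, all of whose
transition probabilities `W x y` (the probability of output `y` on input `x`) are positive. -/
structure Channel (X Y : Type*) [Fintype Y] where
  W : X → Y → ℝ
  pos : ∀ x y, 0 < W x y
  sum_eq_one : ∀ x, ∑ y, W x y = 1

/-- Kullback-Leibler divergence (in nats) of two mass functions on a finite set. It is only used
where `q` is everywhere positive. -/
def klDiv {Y : Type*} [Fintype Y] (p q : Y → ℝ) : ℝ :=
  ∑ y, p y * Real.log (p y / q y)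

namespace Channel

variable {X Y : Type*} [Fintype X] [Fintype Y]

/-- The smallest transition probability `λ`. -/
def minProb (ch : Channel X Y) : ℝ := ⨅ p : X × Y, ch.W p.1 p.2

/-- The output distribution induced by the input distribution `φ`. -/
def outDist (ch : Channel X Y) (φ : X → ℝ) : Y → ℝ := fun y => ∑ x, φ x * ch.W x y

/-- Mutual information (in nats) between input and output, for the input distribution `φ`. -/
def mutualInfo (ch : Channel X Y) (φ : X → ℝ) : ℝ :=
  ∑ x, ∑ y, φ x * ch.W x y * Real.log (ch.W x y / ch.outDist φ y)

/-- The capacity `C`: the maximum of the mutual information over the input distributions. -/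
def capacity (ch : Channel X Y) : ℝ := sSup (ch.mutualInfo '' stdSimplex ℝ X)

/-- `D`: the maximal divergence between the output distributions of two input letters. -/
def maxDiv (ch : Channel X Y) : ℝ := ⨆ p : X × X, klDiv (ch.W p.1) (ch.W p.2)

/-- The function `J`: the maximum of `α D(ψ₁ ‖ W_{x₁}) + (1 - α) D(ψ₂ ‖ W_{x₂})` over
`α ∈ [0, 1]`, input letters `x₁, x₂` and input distributions `φ₁, φ₂` (with output distributions
`ψ₁, ψ₂`) such that `α I(φ₁, W) + (1 - α) I(φ₂, W) ≥ R`. Meaningful for `R ≤ C`. -/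
def J (ch : Channel X Y) (R : ℝ) : ℝ :=
  sSup {v : ℝ | ∃ α ∈ Set.Icc (0 : ℝ) 1, ∃ x₁ x₂ : X,
    ∃ φ₁ ∈ stdSimplex ℝ X, ∃ φ₂ ∈ stdSimplex ℝ X,
      R ≤ α * ch.mutualInfo φ₁ + (1 - α) * ch.mutualInfo φ₂ ∧
      v = α * klDiv (ch.outDist φ₁) (ch.W x₁) + (1 - α) * klDiv (ch.outDist φ₂) (ch.W x₂)}

end Channel

/-- A variable length block code with feedback, with message set `𝓜`. An output sequence is a
function `y : ℕ → Y`, where `y k` is the output letter at time `k + 1`. -/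
structure Code (𝓜 X Y : Type*) where
  /-- `encode m n (y₁, …, yₙ)` is the input letter at time `n + 1`. -/
  encode : 𝓜 → (n : ℕ) → (Fin n → Y) → X
  /-- The decoding time, as a function of the output sequence. -/
  time : (ℕ → Y) → ℕ∞
  one_le_time : ∀ y, 1 ≤ time y
  /-- The decoding time is a Markov time: whether it equals `n` is determined by the first `n`
  outputs. -/
  time_markov : ∀ (n : ℕ) (y z : ℕ → Y), (∀ k < n, y k = z k) → time y = n → time z = n
  /-- The decoded message, as a function of the output sequence. -/
  decode : (ℕ → Y) → 𝓜
  /-- The decoded message depends only on the outputs up to the decoding time. -/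
  decode_time : ∀ y z : ℕ → Y, (∀ k : ℕ, (k : ℕ∞) < time y → y k = z k) → decode y = decode z

/-- The random variables `msg` (the message) and `out k` (the output letter at time `k + 1`) on the
probability space `(Ω, P)` describe the use of the code `c` on the channel `ch`: the message is
uniformly distributed, given the message and the outputs up to time `n` the output at time
`n + 1` is distributed according to the row of `W` of the current input letter, and the decoding
time is almost surely finite. -/
structure IsTransmission {𝓜 X Y Ω : Type*} [Fintype 𝓜] [Fintype Y] [MeasurableSpace Ω]
    (ch : Channel X Y) (c : Code 𝓜 X Y) (P : Measure Ω) (msg : Ω → 𝓜) (out : ℕ → Ω → Y) :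
    Prop where
  measurable_msg : ∀ m, MeasurableSet {ω | msg ω = m}
  measurable_out : ∀ k y, MeasurableSet {ω | out k ω = y}
  uniform : ∀ m, P.real {ω | msg ω = m} = 1 / (Fintype.card 𝓜 : ℝ)
  memoryless : ∀ (m : 𝓜) (n : ℕ) (y : ℕ → Y),
    P.real {ω | msg ω = m ∧ ∀ k < n + 1, out k ω = y k} =
      P.real {ω | msg ω = m ∧ ∀ k < n, out k ω = y k} *
        ch.W (c.encode m n (fun k => y k)) (y n)
  time_finite : ∀ᵐ ω ∂P, c.time (fun k => out k ω) ≠ ⊤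

namespace Code

variable {𝓜 X Y Ω : Type*} [MeasurableSpace Ω]

/-- The expected decoding time `E[τ] ∈ [1, ∞]`. -/
def expTime (c : Code 𝓜 X Y) (P : Measure Ω) (out : ℕ → Ω → Y) : ℝ≥0∞ :=
  ∫⁻ ω, (c.time (fun k => out k ω) : ℝ≥0∞) ∂P

/-- `perUse c P out a` is `a / E[τ]`, which is `0` when `E[τ] = ∞`. -/
def perUse (c : Code 𝓜 X Y) (P : Measure Ω) (out : ℕ → Ω → Y) (a : ℝ) : ℝ :=
  a * ((c.expTime P out)⁻¹).toReal

/-- The error probability `Pe`. -/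
def errProb (c : Code 𝓜 X Y) (P : Measure Ω) (msg : Ω → 𝓜) (out : ℕ → Ω → Y) : ℝ :=
  P.real {ω | c.decode (fun k => out k ω) ≠ msg ω}

/-- For a product message set: the probability that the decoded message differs from the
transmitted one in at least one of the sub-messages with index at most `i`. -/
def subErrProb {ℓ : ℕ} {S : Fin ℓ → Type*} (c : Code (∀ i, S i) X Y) (P : Measure Ω)
    (msg : Ω → ∀ i, S i) (out : ℕ → Ω → Y) (i : Fin ℓ) : ℝ :=
  P.real {ω | ∃ j ≤ i, c.decode (fun k => out k ω) j ≠ msg ω j}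

/-- The rate `R_i = ln |S_i| / E[τ]` of the `i`-th sub-message. -/
def subRate {ℓ : ℕ} {S : Fin ℓ → Type*} [∀ i, Fintype (S i)] (c : Code (∀ i, S i) X Y)
    (P : Measure Ω) (out : ℕ → Ω → Y) (i : Fin ℓ) : ℝ :=
  c.perUse P out (Real.log (Fintype.card (S i)))

/-- The error exponent `E_i = - ln Pe_i / E[τ]` of the `i`-th sub-message. -/
def subExponent {ℓ : ℕ} {S : Fin ℓ → Type*} (c : Code (∀ i, S i) X Y) (P : Measure Ω)
    (msg : Ω → ∀ i, S i) (out : ℕ → Ω → Y) (i : Fin ℓ) : ℝ :=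
  c.perUse P out (-Real.log (c.subErrProb P msg out i))

end Code

end FeedbackUEP

end

/-!
The transmission is studied on the tree of output sequences, on which the posterior distribution of
the message evolves by Bayes' rule (`posterior`). At a node the channel input has, given the past
outputs, a certain distribution `φ`; using the channel there conveys the information `I(φ, W)` about
the message, and the next output can separate two hypotheses on the message by a divergence of at
most `max_x D(ψ_φ ‖ W_x)`.

For every `i` stop at the first time `T_i` when some value of the first `i` sub-messages has posterior
probability at least `1 - δ`, or at the decoding time `τ` if that comes first (`LabelStop`). These
times increase with `i`, so they divide the transmission into phases. Two bounds hold, both of them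
instances of the variational inequality of Donsker and Varadhan on the tree
(`stoppedExp_le_add_klDiv`).
* The value guessed at `T_i` is wrong with probability at most `δ + Pe / δ`, so the channel must have
  conveyed the information `(1 - ε₃) ln |S_1 × ⋯ × S_i| - h(ε₃)` by then
  (`log_card_le_sum_mutualInfo`).
* A single step shrinks a posterior probability at most by the factor `λ`, so at `T_i` the guess is
  still wrong with posterior probability at least `λ δ`. The outputs after `T_i` must therefore refute
  an alternative of substantial probability, and the divergence built up after `T_i` bounds the
  exponent of the error probability (`neg_log_errProb_le_sum_maxDivFrom`).

A phase is thus described by its expected duration, information and divergence. Such triples form a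
convex cone, in which time sharing between two input distributions suffices (`Achievable`, by
`exists_two_point_dominating`), so the divergence of a phase is bounded in terms of `J`
(`Achievable.div_le_J`). Information on a late sub-message may be conveyed early; moving surplus time
to later phases makes every phase convey its own sub-message without weakening the bounds on the
exponents (`exists_redistribution`). The vector `η` lists the resulting durations relative to `E[τ]`.

The bounds for the phases are proved for finite horizons, where expectations are finite sums
(`exists_phases`); they pass to the unlimited horizon because the cone is closed and the durations are
bounded (`exists_phases_of_transmission`).
-/

noncomputable section

namespace FeedbackUEP

/-! ### Divergence of mass functions -/

section Divergence

variable {Y : Type*} [Fintype Y]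

/-- The one-letter variational inequality of Donsker and Varadhan. -/
lemma sum_mul_le_log_sum_exp_add_klDiv {p q : Y → ℝ} (hp : ∀ y, 0 < p y) (hq : ∀ y, 0 < q y)
    (hp1 : ∑ y, p y = 1) (f : Y → ℝ) :
    ∑ y, p y * f y ≤ Real.log (∑ y, q y * Real.exp (f y)) + klDiv p q := by
  have hne : (Finset.univ : Finset Y).Nonempty := by
    by_contra h
    rw [Finset.not_nonempty_iff_eq_empty] at h
    simp [h] at hp1
  set Z := ∑ y, q y * Real.exp (f y) with hZ
  have hZpos : 0 < Z := Finset.sum_pos (fun y _ => mul_pos (hq y) (Real.exp_pos _)) hne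
  have key : ∀ y, p y * f y - p y * Real.log (p y / q y) - p y * Real.log Z
      ≤ q y * Real.exp (f y) / Z - p y := by
    intro y
    have h := Real.log_le_sub_one_of_pos
      (show 0 < q y * Real.exp (f y) / (p y * Z) by have := hp y; have := hq y; positivity)
    rw [Real.log_div (by have := hq y; positivity) (by have := hp y; positivity),
      Real.log_mul (hq y).ne' (Real.exp_pos _).ne', Real.log_exp,
      Real.log_mul (hp y).ne' hZpos.ne'] at h
    rw [Real.log_div (hp y).ne' (hq y).ne']
    have h2 := mul_le_mul_of_nonneg_left h (hp y).le
    have h3 : p y * (q y * Real.exp (f y) / (p y * Z) - 1) = q y * Real.exp (f y) / Z - p y := by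
      have := (hp y).ne'
      field_simp
    rw [h3] at h2
    linarith
  have hsum := Finset.sum_le_sum (fun y (_ : y ∈ Finset.univ) => key y)
  simp only [Finset.sum_sub_distrib, ← Finset.sum_mul, ← Finset.sum_div, hp1, ← hZ] at hsum
  rw [div_self hZpos.ne'] at hsum
  unfold klDiv
  linarith

lemma klDiv_nonneg {p q : Y → ℝ} (hp : ∀ y, 0 < p y) (hq : ∀ y, 0 < q y)
    (hp1 : ∑ y, p y = 1) (hq1 : ∑ y, q y = 1) : 0 ≤ klDiv p q := by
  simpa [hq1] using sum_mul_le_log_sum_exp_add_klDiv hp hq hp1 (fun _ => 0)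

/-- Gibbs' inequality, relative to a reference mass function `w`. -/
lemma sum_mul_log_div_le_klDiv {p q w : Y → ℝ} (hp : ∀ y, 0 < p y) (hq : ∀ y, 0 < q y)
    (hw : ∀ y, 0 < w y) (hp1 : ∑ y, p y = 1) (hq1 : ∑ y, q y = 1) :
    ∑ y, p y * Real.log (q y / w y) ≤ klDiv p w := by
  have h := sum_mul_le_log_sum_exp_add_klDiv hp hw hp1 (fun y => Real.log (q y / w y))
  have : ∀ y, w y * Real.exp (Real.log (q y / w y)) = q y := fun y => by
    rw [Real.exp_log (div_pos (hq y) (hw y)), mul_div_cancel₀ _ (hw y).ne']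
  simpa [this, hq1] using h

/-- Convexity of the divergence in its second argument. -/
lemma klDiv_mixture_right_le {ι : Type*} [Fintype ι] {p : Y → ℝ} (hp : ∀ y, 0 < p y)
    {a : ι → ℝ} (ha : ∀ i, 0 ≤ a i) (ha1 : ∑ i, a i = 1) {w : ι → Y → ℝ}
    (hw : ∀ i y, 0 < w i y) :
    klDiv p (fun y => ∑ i, a i * w i y) ≤ ∑ i, a i * klDiv p (w i) := by
  have hpos : ∀ y, 0 < ∑ i, a i * w i y := by
    intro y
    obtain ⟨i, -, hi⟩ : ∃ i ∈ Finset.univ, 0 < a i := by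
      by_contra! h
      have := Finset.sum_nonpos h
      linarith
    exact Finset.sum_pos' (fun i _ => mul_nonneg (ha i) (hw i y).le)
      ⟨i, Finset.mem_univ i, mul_pos hi (hw i y)⟩
  have hlog : ∀ y, ∑ i, a i * Real.log (w i y) ≤ Real.log (∑ i, a i * w i y) := by
    intro y
    have := strictConcaveOn_log_Ioi.concaveOn.le_map_sum (t := Finset.univ) (w := a)
      (p := fun i => w i y) (fun i _ => ha i) ha1 (fun i _ => hw i y)
    simpa using this
  unfold klDiv
  simp only [Finset.mul_sum]
  rw [Finset.sum_comm]
  refine Finset.sum_le_sum fun y _ => ?_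
  rw [Real.log_div (hp y).ne' (hpos y).ne']
  have : ∑ i, a i * (p y * Real.log (p y / w i y))
      = p y * (Real.log (p y) - ∑ i, a i * Real.log (w i y)) := by
    have h1 : ∀ i, a i * (p y * Real.log (p y / w i y))
        = p y * Real.log (p y) * a i - p y * (a i * Real.log (w i y)) := fun i => by
      rw [Real.log_div (hp y).ne' (hw i y).ne']; ring
    simp only [h1, Finset.sum_sub_distrib, ← Finset.mul_sum, ha1]
    ring
  rw [this]
  exact mul_le_mul_of_nonneg_left (by linarith [hlog y]) (hp y).le

end Divergence

/-! ### Stopped chains on the tree of output sequences -/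

section Tree

variable {Y : Type*} [Fintype Y]

/-- A transition kernel on the tree of output sequences with positive probabilities. A node of the
tree is the list of the outputs so far, the latest one first, so that the children of `s` are the
lists `y :: s`. -/
structure IsKernel (k : List Y → Y → ℝ) : Prop where
  pos : ∀ s y, 0 < k s y
  sum_eq_one : ∀ s, ∑ y, k s y = 1

open Classical in
/-- One step of the chain with kernel `k` that stays put at the nodes satisfying `σ`, as an operator
on functions of the node. -/
def stoppedStep (k : List Y → Y → ℝ) (σ : List Y → Prop) (f : List Y → ℝ) (s : List Y) : ℝ :=
  if σ s then f s else ∑ y, k s y * f (y :: s)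

/-- The expectation of `f` at time `n` for the chain that starts at the root, moves according to
`k` and is stopped at the first node satisfying `σ`. -/
def stoppedExp (k : List Y → Y → ℝ) (σ : List Y → Prop) : ℕ → (List Y → ℝ) → ℝ
  | 0, f => f []
  | n + 1, f => stoppedExp k σ n (stoppedStep k σ f)

/-- The nodes that a chain stopped at `σ` can visit: those whose parent does not satisfy `σ`. -/
def Fresh (σ : List Y → Prop) : List Y → Prop
  | [] => True
  | _ :: s => ¬ σ s

variable {k k' : List Y → Y → ℝ} {σ ρ : List Y → Prop}

lemma stoppedExp_mono_of_fresh (hk : IsKernel k) {f g : List Y → ℝ}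
    (h : ∀ s, Fresh σ s → f s ≤ g s) (n : ℕ) : stoppedExp k σ n f ≤ stoppedExp k σ n g := by
  induction n generalizing f g with
  | zero => exact h [] trivial
  | succ n ih =>
    refine ih fun s hs => ?_
    unfold stoppedStep
    split_ifs with hσ
    · exact h s hs
    · exact Finset.sum_le_sum fun y _ => mul_le_mul_of_nonneg_left (h _ hσ) (hk.pos s y).le

lemma stoppedExp_mono (hk : IsKernel k) {f g : List Y → ℝ} (h : ∀ s, f s ≤ g s) (n : ℕ) :
    stoppedExp k σ n f ≤ stoppedExp k σ n g :=
  stoppedExp_mono_of_fresh hk (fun s _ => h s) n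

lemma stoppedExp_const (hk : IsKernel k) (c : ℝ) (n : ℕ) :
    stoppedExp k σ n (fun _ => c) = c := by
  induction n with
  | zero => rfl
  | succ n ih =>
    have : stoppedStep k σ (fun _ => c) = fun _ => c := by
      funext s
      simp [stoppedStep, ← Finset.sum_mul, hk.sum_eq_one]
    rw [stoppedExp, this, ih]

lemma stoppedExp_add (f g : List Y → ℝ) (n : ℕ) :
    stoppedExp k σ n (fun s => f s + g s) = stoppedExp k σ n f + stoppedExp k σ n g := by
  induction n generalizing f g with
  | zero => rfl
  | succ n ih =>
    have : stoppedStep k σ (fun s => f s + g s)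
        = fun s => stoppedStep k σ f s + stoppedStep k σ g s := by
      funext s
      unfold stoppedStep
      split_ifs
      · rfl
      · simp [mul_add, Finset.sum_add_distrib]
    rw [stoppedExp, this, ih]
    rfl

lemma stoppedExp_const_mul (c : ℝ) (f : List Y → ℝ) (n : ℕ) :
    stoppedExp k σ n (fun s => c * f s) = c * stoppedExp k σ n f := by
  induction n generalizing f with
  | zero => rfl
  | succ n ih =>
    have : stoppedStep k σ (fun s => c * f s) = fun s => c * stoppedStep k σ f s := by
      funext s
      unfold stoppedStep
      split_ifs
      · rfl
      · simp [Finset.mul_sum, mul_left_comm]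
    rw [stoppedExp, this, ih]
    rfl

lemma stoppedExp_sum {ι : Type*} (t : Finset ι) (hk : IsKernel k) (f : ι → List Y → ℝ) (n : ℕ) :
    stoppedExp k σ n (fun s => ∑ i ∈ t, f i s) = ∑ i ∈ t, stoppedExp k σ n (f i) := by
  classical
  induction t using Finset.induction_on with
  | empty => simpa using stoppedExp_const hk 0 n
  | insert a t ha ih => simp only [Finset.sum_insert ha, stoppedExp_add, ih]

lemma stoppedExp_nonneg (hk : IsKernel k) {f : List Y → ℝ} (h : ∀ s, 0 ≤ f s) (n : ℕ) :
    0 ≤ stoppedExp k σ n f := by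
  rw [← stoppedExp_const (σ := σ) hk 0 n]
  exact stoppedExp_mono hk h n

/-- Optional stopping: stopping earlier decreases the expectation of a function that is
subharmonic from the earlier stopping time on. -/
lemma stoppedExp_le_of_subharmonic (hk : IsKernel k) (hσ : ∀ s y, σ s → σ (y :: s))
    (hρσ : ∀ s, ρ s → σ s) {f : List Y → ℝ}
    (hf : ∀ s, σ s → f s ≤ stoppedStep k ρ f s) (n : ℕ) :
    stoppedExp k σ n f ≤ stoppedExp k ρ n f := by
  induction n generalizing f with
  | zero => exact le_rfl
  | succ n ih =>
    have h1 : ∀ s, stoppedStep k σ f s ≤ stoppedStep k ρ f s := by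
      intro s
      by_cases hs : σ s
      · rw [stoppedStep, if_pos hs]
        exact hf s hs
      · simp [stoppedStep, hs, mt (hρσ s) hs]
    refine (stoppedExp_mono hk h1 n).trans (ih fun s hs => ?_)
    by_cases hr : ρ s
    · simp [stoppedStep, hr]
    · rw [stoppedStep, if_neg hr, stoppedStep, if_neg hr]
      exact Finset.sum_le_sum fun y _ =>
        mul_le_mul_of_nonneg_left (hf _ (hσ s y hs)) (hk.pos s y).le

lemma stoppedExp_eq_of_harmonic (hσ : ∀ s y, σ s → σ (y :: s))
    (hρσ : ∀ s, ρ s → σ s) {f : List Y → ℝ}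
    (hf : ∀ s, σ s → stoppedStep k ρ f s = f s) (n : ℕ) :
    stoppedExp k σ n f = stoppedExp k ρ n f := by
  induction n generalizing f with
  | zero => rfl
  | succ n ih =>
    have h1 : stoppedStep k σ f = stoppedStep k ρ f := by
      funext s
      by_cases hs : σ s
      · rw [hf s hs, stoppedStep, if_pos hs]
      · simp [stoppedStep, hs, mt (hρσ s) hs]
    rw [stoppedExp, stoppedExp, h1]
    refine ih fun s hs => ?_
    by_cases hr : ρ s
    · simp [stoppedStep, hr]
    · rw [stoppedStep, if_neg hr, stoppedStep, if_neg hr]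
      exact Finset.sum_congr rfl fun y _ => by rw [hf _ (hσ s y hs)]

/-- Functions that vanish from `σ` on do not distinguish `σ` from later stopping times. -/
lemma stoppedExp_eq_of_eq_zero (hσ : ∀ s y, σ s → σ (y :: s))
    (hρσ : ∀ s, ρ s → σ s) {f : List Y → ℝ} (hf : ∀ s, σ s → f s = 0) (n : ℕ) :
    stoppedExp k σ n f = stoppedExp k ρ n f := by
  refine stoppedExp_eq_of_harmonic hσ hρσ (fun s hs => ?_) n
  have : ∀ y, f (y :: s) = 0 := fun y => hf _ (hσ s y hs)
  simp [stoppedStep, hf s hs, this]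

open Classical in
/-- The variational inequality of Donsker and Varadhan for stopped chains, with the divergence
written as a sum over the steps by the chain rule, and with `log z` weakened to `z - 1`. -/
lemma stoppedExp_le_add_klDiv (hk : IsKernel k) (hk' : IsKernel k') (f : List Y → ℝ) (N : ℕ) :
    stoppedExp k σ N f ≤ stoppedExp k' σ N (fun s => Real.exp (f s)) - 1 +
      ∑ n ∈ Finset.range N, stoppedExp k σ n (fun s => if σ s then 0 else klDiv (k s) (k' s)) := by
  induction N generalizing f with
  | zero =>
    have := Real.add_one_le_exp (f [])
    simp only [stoppedExp, Finset.range_zero, Finset.sum_empty]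
    linarith
  | succ N ih =>
    set g : List Y → ℝ := fun s =>
      if σ s then f s else Real.log (∑ y, k' s y * Real.exp (f (y :: s))) with hg
    have h1 : ∀ s, stoppedStep k σ f s ≤ g s + (if σ s then 0 else klDiv (k s) (k' s)) := by
      intro s
      by_cases hs : σ s
      · simp [stoppedStep, hg, hs]
      · simpa [stoppedStep, hg, hs] using
          sum_mul_le_log_sum_exp_add_klDiv (hk.pos s) (hk'.pos s) (hk.sum_eq_one s) _
    have h2 : (fun s => Real.exp (g s)) = stoppedStep k' σ (fun s => Real.exp (f s)) := by
      funext s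
      by_cases hs : σ s
      · simp [stoppedStep, hg, hs]
      · have hne : (Finset.univ : Finset Y).Nonempty := by
          by_contra h
          rw [Finset.not_nonempty_iff_eq_empty] at h
          have := hk.sum_eq_one s
          simp [h] at this
        simp only [stoppedStep, hg, hs, if_false]
        exact Real.exp_log
          (Finset.sum_pos (fun y _ => mul_pos (hk'.pos s y) (Real.exp_pos _)) hne)
    have h3 := stoppedExp_mono (σ := σ) hk h1 N
    rw [stoppedExp_add] at h3
    have h4 := ih g
    rw [h2] at h4
    rw [Finset.sum_range_succ]
    simp only [stoppedExp]
    linarith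

end Tree

/-! ### Information quantities of the channel -/

section ChannelInfo

variable {X Y : Type*} [Fintype X] [Fintype Y] (ch : Channel X Y)

lemma Channel.outDist_pos {φ : X → ℝ} (hφ : φ ∈ stdSimplex ℝ X) (y : Y) : 0 < ch.outDist φ y := by
  obtain ⟨x, -, hx⟩ : ∃ x ∈ Finset.univ, 0 < φ x := by
    by_contra! h
    have := Finset.sum_nonpos h
    linarith [hφ.2]
  exact Finset.sum_pos' (fun x _ => mul_nonneg (hφ.1 x) (ch.pos x y).le)
    ⟨x, Finset.mem_univ x, mul_pos hx (ch.pos x y)⟩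

lemma Channel.sum_outDist {φ : X → ℝ} (hφ : φ ∈ stdSimplex ℝ X) : ∑ y, ch.outDist φ y = 1 := by
  unfold Channel.outDist
  rw [Finset.sum_comm]
  simp [← Finset.mul_sum, ch.sum_eq_one, hφ.2]

lemma Channel.mutualInfo_eq_sum_klDiv (φ : X → ℝ) :
    ch.mutualInfo φ = ∑ x, φ x * klDiv (ch.W x) (ch.outDist φ) := by
  simp [Channel.mutualInfo, klDiv, Finset.mul_sum, mul_assoc]

lemma Channel.continuous_outDist (y : Y) :
    Continuous (fun φ : X → ℝ => ch.outDist φ y) := by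
  unfold Channel.outDist
  fun_prop

lemma Channel.continuousOn_mutualInfo : ContinuousOn ch.mutualInfo (stdSimplex ℝ X) := by
  unfold Channel.mutualInfo
  refine continuousOn_finsetSum _ fun x _ => continuousOn_finsetSum _ fun y _ => ?_
  refine ContinuousOn.mul (by fun_prop) (ContinuousOn.log (ContinuousOn.div continuousOn_const
    (ch.continuous_outDist y).continuousOn fun φ hφ => (ch.outDist_pos hφ y).ne') ?_)
  exact fun φ hφ => (div_pos (ch.pos x y) (ch.outDist_pos hφ y)).ne'

lemma Channel.continuousOn_klDiv_outDist (x : X) :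
    ContinuousOn (fun φ => klDiv (ch.outDist φ) (ch.W x)) (stdSimplex ℝ X) := by
  unfold klDiv
  refine continuousOn_finsetSum _ fun y _ => ?_
  have h := (ch.continuous_outDist y).continuousOn (s := stdSimplex ℝ X)
  refine h.mul (ContinuousOn.log (h.div_const _) fun φ hφ => ?_)
  exact (div_pos (ch.outDist_pos hφ y) (ch.pos x y)).ne'

lemma Channel.mutualInfo_le_capacity {φ : X → ℝ} (hφ : φ ∈ stdSimplex ℝ X) :
    ch.mutualInfo φ ≤ ch.capacity :=
  le_csSup ((isCompact_stdSimplex ℝ X).image_of_continuousOn ch.continuousOn_mutualInfo).bddAbove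
    (Set.mem_image_of_mem _ hφ)

lemma Channel.klDiv_outDist_le_maxDiv {φ : X → ℝ} (hφ : φ ∈ stdSimplex ℝ X) (x : X) :
    klDiv (ch.outDist φ) (ch.W x) ≤ ch.maxDiv := by
  have h1 : klDiv (ch.outDist φ) (ch.W x)
      = ∑ x', φ x' * ∑ y, ch.W x' y * Real.log (ch.outDist φ y / ch.W x y) := by
    unfold klDiv
    simp only [Finset.mul_sum]
    rw [Finset.sum_comm]
    refine Finset.sum_congr rfl fun y _ => ?_
    conv_lhs => rw [Channel.outDist]
    simp [Finset.sum_mul, mul_assoc, Channel.outDist]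
  have h2 : ∀ x', φ x' * ∑ y, ch.W x' y * Real.log (ch.outDist φ y / ch.W x y)
      ≤ φ x' * ch.maxDiv := fun x' => by
    refine mul_le_mul_of_nonneg_left ?_ (hφ.1 x')
    refine (sum_mul_log_div_le_klDiv (ch.pos x') (ch.outDist_pos hφ) (ch.pos x)
      (ch.sum_eq_one x') (ch.sum_outDist hφ)).trans ?_
    exact le_ciSup (f := fun p : X × X => klDiv (ch.W p.1) (ch.W p.2))
      (Set.finite_range _).bddAbove (x', x)
  rw [h1]
  calc _ ≤ ∑ x', φ x' * ch.maxDiv := Finset.sum_le_sum fun x' _ => h2 x'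
    _ = ch.maxDiv := by rw [← Finset.sum_mul, hφ.2, one_mul]

lemma Channel.maxDiv_nonneg [Nonempty X] : 0 ≤ ch.maxDiv := by
  let x : X := Classical.arbitrary X
  refine le_trans ?_ (le_ciSup (f := fun p : X × X => klDiv (ch.W p.1) (ch.W p.2))
      (Set.finite_range _).bddAbove (x, x))
  exact klDiv_nonneg (ch.pos x) (ch.pos x) (ch.sum_eq_one x) (ch.sum_eq_one x)

/-- The largest divergence of the output distribution of `φ` from a row of the channel. -/
def Channel.maxDivFrom (φ : X → ℝ) : ℝ := ⨆ x, klDiv (ch.outDist φ) (ch.W x)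

lemma Channel.klDiv_le_maxDivFrom (φ : X → ℝ) (x : X) :
    klDiv (ch.outDist φ) (ch.W x) ≤ ch.maxDivFrom φ :=
  le_ciSup (f := fun x => klDiv (ch.outDist φ) (ch.W x)) (Set.finite_range _).bddAbove x

lemma Channel.maxDivFrom_nonneg [Nonempty X] {φ : X → ℝ} (hφ : φ ∈ stdSimplex ℝ X) :
    0 ≤ ch.maxDivFrom φ :=
  (klDiv_nonneg (ch.outDist_pos hφ) (ch.pos _) (ch.sum_outDist hφ) (ch.sum_eq_one _)).trans
    (ch.klDiv_le_maxDivFrom φ (Classical.arbitrary X))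

lemma Channel.maxDivFrom_le_maxDiv [Nonempty X] {φ : X → ℝ} (hφ : φ ∈ stdSimplex ℝ X) :
    ch.maxDivFrom φ ≤ ch.maxDiv :=
  ciSup_le fun x => ch.klDiv_outDist_le_maxDiv hφ x

lemma Channel.minProb_le (x : X) (y : Y) : ch.minProb ≤ ch.W x y :=
  ciInf_le (f := fun p : X × Y => ch.W p.1 p.2) (Set.finite_range _).bddBelow (x, y)

omit [Fintype X] in
lemma Channel.nonempty_output (ch : Channel X Y) [Nonempty X] : Nonempty Y := by
  by_contra h
  rw [not_nonempty_iff] at h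
  simpa using ch.sum_eq_one (Classical.arbitrary X)

omit [Fintype X] in
lemma Channel.W_le_one (x : X) (y : Y) : ch.W x y ≤ 1 := by
  rw [← ch.sum_eq_one x]
  exact Finset.single_le_sum (fun y _ => (ch.pos x y).le) (Finset.mem_univ y)

lemma Channel.minProb_pos [Nonempty X] : 0 < ch.minProb := by
  have := ch.nonempty_output
  obtain ⟨p, hp⟩ := exists_eq_ciInf_of_finite (f := fun p : X × Y => ch.W p.1 p.2)
  rw [Channel.minProb, ← hp]
  exact ch.pos _ _

lemma Channel.minProb_le_one [Nonempty X] : ch.minProb ≤ 1 := by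
  have := ch.nonempty_output
  exact (ch.minProb_le (Classical.arbitrary X) (Classical.arbitrary Y)).trans (ch.W_le_one _ _)

end ChannelInfo

/-! ### Posterior distributions of the message -/

section Posterior

variable {X Y 𝓜 : Type*} [Fintype Y] [Fintype 𝓜] (ch : Channel X Y)
  (enc : 𝓜 → List Y → X)

/-- The posterior probability of the message `m` at the node `s`, for a uniform prior and the
encoder `enc`. -/
def posterior : List Y → 𝓜 → ℝ
  | [], _ => 1 / (Fintype.card 𝓜 : ℝ)
  | y :: s, m => posterior s m * ch.W (enc m s) y / ∑ m', posterior s m' * ch.W (enc m' s) y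

/-- The conditional distribution of the next output at the node `s`. -/
def predictive (s : List Y) (y : Y) : ℝ := ∑ m, posterior ch enc s m * ch.W (enc m s) y

/-- The conditional distribution of the next output at the node `s` given the message `m`. -/
def messageKernel (m : 𝓜) (s : List Y) (y : Y) : ℝ := ch.W (enc m s) y

omit [Fintype 𝓜] in
lemma isKernel_messageKernel (m : 𝓜) : IsKernel (messageKernel ch enc m) :=
  ⟨fun _ y => ch.pos _ y, fun _ => ch.sum_eq_one _⟩

variable [Nonempty 𝓜]

lemma posterior_pos (s : List Y) (m : 𝓜) : 0 < posterior ch enc s m := by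
  induction s generalizing m with
  | nil =>
    have : (0 : ℝ) < Fintype.card 𝓜 := by exact_mod_cast Fintype.card_pos
    simpa [posterior] using this
  | cons y s ih =>
    exact div_pos (mul_pos (ih m) (ch.pos _ _))
      (Finset.sum_pos (fun m' _ => mul_pos (ih m') (ch.pos _ _)) Finset.univ_nonempty)

lemma predictive_pos (s : List Y) (y : Y) : 0 < predictive ch enc s y :=
  Finset.sum_pos (fun m _ => mul_pos (posterior_pos ch enc s m) (ch.pos _ _))
    Finset.univ_nonempty

lemma sum_posterior (s : List Y) : ∑ m, posterior ch enc s m = 1 := by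
  cases s with
  | nil =>
    have : (Fintype.card 𝓜 : ℝ) ≠ 0 := by exact_mod_cast Fintype.card_ne_zero
    simp [posterior, this]
  | cons y s =>
    simp only [posterior, ← Finset.sum_div]
    exact div_self (predictive_pos ch enc s y).ne'

lemma isKernel_predictive : IsKernel (predictive ch enc) := by
  refine ⟨predictive_pos ch enc, fun s => ?_⟩
  unfold predictive
  rw [Finset.sum_comm]
  simp [← Finset.mul_sum, ch.sum_eq_one, sum_posterior]

/-- Bayes' rule. -/
lemma predictive_mul_posterior (s : List Y) (y : Y) (m : 𝓜) :
    predictive ch enc s y * posterior ch enc (y :: s) m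
      = posterior ch enc s m * messageKernel ch enc m s y := by
  have := (predictive_pos ch enc s y).ne'
  change predictive ch enc s y * (posterior ch enc s m * ch.W (enc m s) y / predictive ch enc s y)
    = _
  rw [mul_div_cancel₀ _ this]
  rfl

/-- Averaging over the message the chains with a known message gives the chain of the outputs, with
the posterior distribution of the message at its final node. -/
lemma average_stoppedExp_messageKernel (σ : List Y → Prop) (f : 𝓜 → List Y → ℝ) (n : ℕ) :
    ∑ m, 1 / (Fintype.card 𝓜 : ℝ) * stoppedExp (messageKernel ch enc m) σ n (f m)
      = stoppedExp (predictive ch enc) σ n (fun s => ∑ m, posterior ch enc s m * f m s) := by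
  induction n generalizing f with
  | zero => simp [stoppedExp, posterior]
  | succ n ih =>
    simp only [stoppedExp]
    rw [ih]
    congr 1
    funext s
    unfold stoppedStep
    split_ifs
    · rfl
    · simp only [Finset.mul_sum]
      rw [Finset.sum_comm]
      refine Finset.sum_congr rfl fun y _ => Finset.sum_congr rfl fun m _ => ?_
      rw [← mul_assoc, ← predictive_mul_posterior, mul_assoc]

open Classical in
/-- The posterior probability of the set `p` of messages at the node `s`. -/
def postProb (s : List Y) (p : 𝓜 → Prop) : ℝ :=
  ∑ m, posterior ch enc s m * (if p m then 1 else 0)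

lemma postProb_nonneg (s : List Y) (p : 𝓜 → Prop) : 0 ≤ postProb ch enc s p :=
  Finset.sum_nonneg fun m _ => mul_nonneg (posterior_pos ch enc s m).le (by split_ifs <;> simp)

lemma postProb_mono (s : List Y) {p q : 𝓜 → Prop} (h : ∀ m, p m → q m) :
    postProb ch enc s p ≤ postProb ch enc s q := by
  refine Finset.sum_le_sum fun m _ => mul_le_mul_of_nonneg_left ?_ (posterior_pos ch enc s m).le
  by_cases hp : p m
  · simp [hp, h m hp]
  · simp only [hp, if_false]
    split_ifs <;> simp

lemma postProb_le_one (s : List Y) (p : 𝓜 → Prop) : postProb ch enc s p ≤ 1 := by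
  refine (postProb_mono ch enc s (q := fun _ => True) fun _ _ => trivial).trans ?_
  simp [postProb, sum_posterior]

lemma postProb_add_not (s : List Y) (p : 𝓜 → Prop) :
    postProb ch enc s p + postProb ch enc s (fun m => ¬ p m) = 1 := by
  unfold postProb
  rw [← Finset.sum_add_distrib]
  conv_rhs => rw [← sum_posterior ch enc s]
  refine Finset.sum_congr rfl fun m _ => ?_
  by_cases hp : p m <;> simp [hp]

lemma one_le_postProb_add (s : List Y) {p q : 𝓜 → Prop} (h : ∀ m, p m ∨ q m) :
    1 ≤ postProb ch enc s p + postProb ch enc s q := by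
  rw [← postProb_add_not ch enc s p]
  gcongr
  exact postProb_mono ch enc s fun m hm => (h m).resolve_left hm

/-- Posterior probabilities form a martingale. -/
lemma sum_predictive_mul_postProb (s : List Y) (p : 𝓜 → Prop) :
    ∑ y, predictive ch enc s y * postProb ch enc (y :: s) p = postProb ch enc s p := by
  unfold postProb
  simp only [Finset.mul_sum]
  rw [Finset.sum_comm]
  refine Finset.sum_congr rfl fun m _ => ?_
  simp only [← mul_assoc, predictive_mul_posterior]
  rw [← Finset.sum_mul, ← Finset.mul_sum, (isKernel_messageKernel ch enc m).sum_eq_one, mul_one]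

open Classical in
/-- The conditional distribution of the next channel input at the node `s`. -/
def inputDist (s : List Y) (x : X) : ℝ := ∑ m, if enc m s = x then posterior ch enc s m else 0

variable [Fintype X]

omit [Nonempty 𝓜] in
lemma sum_inputDist_mul (s : List Y) (f : X → ℝ) :
    ∑ x, inputDist ch enc s x * f x = ∑ m, posterior ch enc s m * f (enc m s) := by
  classical
  unfold inputDist
  simp only [Finset.sum_mul]
  rw [Finset.sum_comm]
  refine Finset.sum_congr rfl fun m _ => ?_
  simp [ite_mul]

lemma inputDist_mem (s : List Y) : inputDist ch enc s ∈ stdSimplex ℝ X := by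
  constructor
  · intro x
    refine Finset.sum_nonneg fun m _ => ?_
    split_ifs
    exacts [(posterior_pos ch enc s m).le, le_rfl]
  · have := sum_inputDist_mul ch enc s (fun _ => 1)
    simpa [sum_posterior] using this

omit [Nonempty 𝓜] in
lemma outDist_inputDist (s : List Y) : ch.outDist (inputDist ch enc s) = predictive ch enc s := by
  funext y
  exact sum_inputDist_mul ch enc s (fun x => ch.W x y)

omit [Nonempty 𝓜] in
lemma mutualInfo_inputDist (s : List Y) :
    ch.mutualInfo (inputDist ch enc s)
      = ∑ m, posterior ch enc s m * klDiv (messageKernel ch enc m s) (predictive ch enc s) := by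
  rw [ch.mutualInfo_eq_sum_klDiv, sum_inputDist_mul, outDist_inputDist]
  rfl

/-- A posterior probability shrinks in one step at most by the factor `λ`. -/
lemma minProb_mul_postProb_le (s : List Y) (y : Y) (p : 𝓜 → Prop) :
    ch.minProb * postProb ch enc s p ≤ postProb ch enc (y :: s) p := by
  have hpos := predictive_pos ch enc s y
  have hle : predictive ch enc s y ≤ 1 := by
    rw [← (isKernel_predictive ch enc).sum_eq_one s]
    exact Finset.single_le_sum (fun y _ => (predictive_pos ch enc s y).le) (Finset.mem_univ y)
  unfold postProb
  rw [Finset.mul_sum]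
  refine Finset.sum_le_sum fun m _ => ?_
  rw [← mul_assoc]
  refine mul_le_mul_of_nonneg_right ?_ (by split_ifs <;> simp)
  have hm := posterior_pos ch enc (y :: s) m
  calc ch.minProb * posterior ch enc s m
      ≤ posterior ch enc s m * messageKernel ch enc m s y := by
        rw [mul_comm]
        exact mul_le_mul_of_nonneg_left (ch.minProb_le _ _) (posterior_pos ch enc s m).le
    _ = predictive ch enc s y * posterior ch enc (y :: s) m :=
        (predictive_mul_posterior ch enc s y m).symm
    _ ≤ posterior ch enc (y :: s) m := by nlinarith

end Posterior

/-! ### Reliable knowledge of a part of the message -/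

section Label

open scoped Classical

variable {X Y 𝓜 β : Type*} [Fintype Y] [Fintype 𝓜] (ch : Channel X Y)
  (enc : 𝓜 → List Y → X) (τ : List Y → Prop) (g : 𝓜 → β) (δ : ℝ)

/-- Some value of the label `g` of the message has posterior probability at least `1 - δ`. -/
def Concentrated (s : List Y) : Prop :=
  ∃ m, 1 - δ ≤ postProb ch enc s (fun m' => g m' = g m)

/-- The nodes at or after which either decoding has taken place (`τ`) or the posterior distribution
of the label `g` has been concentrated. -/
def LabelStop : List Y → Prop
  | [] => τ [] ∨ Concentrated ch enc g δ []
  | y :: s => LabelStop s ∨ τ (y :: s) ∨ Concentrated ch enc g δ (y :: s)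

variable {ch enc τ g δ}

lemma LabelStop.cons (s : List Y) (y : Y) (h : LabelStop ch enc τ g δ s) :
    LabelStop ch enc τ g δ (y :: s) :=
  Or.inl h

lemma labelStop_of_stop (s : List Y) (h : τ s) : LabelStop ch enc τ g δ s := by
  cases s with
  | nil => exact Or.inl h
  | cons y s => exact Or.inr (Or.inl h)

lemma LabelStop.of_fresh {s : List Y} (hs : Fresh (LabelStop ch enc τ g δ) s)
    (h : LabelStop ch enc τ g δ s) : τ s ∨ Concentrated ch enc g δ s := by
  cases s with
  | nil => exact h
  | cons y s => exact h.resolve_left hs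

lemma not_concentrated_of_not_labelStop {s : List Y} (h : ¬ LabelStop ch enc τ g δ s) :
    ¬ Concentrated ch enc g δ s := by
  cases s with
  | nil => exact fun hc => h (Or.inr hc)
  | cons y s => exact fun hc => h (Or.inr (Or.inr hc))

variable [Nonempty 𝓜]

/-- A coarser label is known no later than a finer one. -/
lemma LabelStop.of_finer {γ : Type*} {g' : 𝓜 → γ} (hgg : ∀ m m', g m = g m' → g' m = g' m')
    {s : List Y} (h : LabelStop ch enc τ g δ s) : LabelStop ch enc τ g' δ s := by
  have hc : ∀ t, Concentrated ch enc g δ t → Concentrated ch enc g' δ t := fun t ⟨m, hm⟩ =>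
    ⟨m, hm.trans (postProb_mono ch enc t fun m' => hgg m' m)⟩
  induction s with
  | nil => exact h.imp_right (hc _)
  | cons y s ih => exact h.imp ih (Or.imp_right (hc _))

variable (ch enc τ g δ)

lemma exists_likeliest (s : List Y) : ∃ a, ∀ m,
    postProb ch enc s (fun m' => g m' = g m) ≤ postProb ch enc s (fun m' => g m' = g a) :=
  Finite.exists_max fun m => postProb ch enc s (fun m' => g m' = g m)

/-- A message whose label is the most probable one at the node `s`. -/
def likeliest (s : List Y) : 𝓜 := (exists_likeliest ch enc g s).choose

/-- A message with the most probable label, frozen from the first node satisfying `LabelStop` on. -/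
def guess : List Y → 𝓜
  | [] => likeliest ch enc g []
  | y :: s => if LabelStop ch enc τ g δ s then guess s else likeliest ch enc g (y :: s)

/-- The posterior probability that the label differs from the one that is guessed. -/
def missProb (s : List Y) : ℝ :=
  postProb ch enc s (fun m => g m ≠ g (guess ch enc τ g δ s))

variable {ch enc τ g δ}

lemma guess_of_fresh {s : List Y} (hs : Fresh (LabelStop ch enc τ g δ) s) :
    guess ch enc τ g δ s = likeliest ch enc g s := by
  cases s with
  | nil => rfl
  | cons y s => exact if_neg hs

lemma guess_cons {s : List Y} (hs : LabelStop ch enc τ g δ s) (y : Y) :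
    guess ch enc τ g δ (y :: s) = guess ch enc τ g δ s :=
  if_pos hs

/-- From the time when the guess is frozen on, its posterior error probability is a martingale. -/
lemma sum_predictive_mul_missProb {s : List Y} (hs : LabelStop ch enc τ g δ s) :
    ∑ y, predictive ch enc s y * missProb ch enc τ g δ (y :: s) = missProb ch enc τ g δ s := by
  simp only [missProb, guess_cons hs]
  exact sum_predictive_mul_postProb ch enc s _

lemma missProb_nonneg (s : List Y) : 0 ≤ missProb ch enc τ g δ s := postProb_nonneg _ _ _ _

lemma missProb_eq_sum (s : List Y) : missProb ch enc τ g δ s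
    = ∑ m, posterior ch enc s m * (if g m = g (guess ch enc τ g δ s) then 0 else 1) := by
  unfold missProb postProb
  refine Finset.sum_congr rfl fun m _ => ?_
  by_cases h : g m = g (guess ch enc τ g δ s) <;> simp [h]

/-- When the guess is frozen, its error probability is at most `δ`, except if decoding takes
place while the label is uncertain; then the decoding error has probability at least `δ`. -/
lemma missProb_le_of_fresh (hδ : 0 < δ) (dec : List Y → 𝓜) {s : List Y}
    (hs : Fresh (LabelStop ch enc τ g δ) s) (h : LabelStop ch enc τ g δ s) :
    missProb ch enc τ g δ s
      ≤ δ + 1 / δ * (if τ s then postProb ch enc s (fun m => m ≠ dec s) else 0) := by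
  have hmiss : missProb ch enc τ g δ s
      = 1 - postProb ch enc s (fun m' => g m' = g (likeliest ch enc g s)) := by
    rw [missProb, guess_of_fresh hs]
    linarith [postProb_add_not ch enc s (fun m' => g m' = g (likeliest ch enc g s))]
  have hmax := (exists_likeliest ch enc g s).choose_spec
  change ∀ m, _ ≤ postProb ch enc s (fun m' => g m' = g (likeliest ch enc g s)) at hmax
  have hnn := postProb_nonneg ch enc s (fun m => m ≠ dec s)
  have hrest : 0 ≤ 1 / δ * (if τ s then postProb ch enc s (fun m => m ≠ dec s) else 0) := by
    split_ifs
    · positivity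
    · simp
  by_cases hc : Concentrated ch enc g δ s
  · obtain ⟨m, hm⟩ := hc
    linarith [hmax m]
  · have hτ : τ s := (LabelStop.of_fresh hs h).resolve_right hc
    have h1 : postProb ch enc s (fun m' => g m' = g (dec s)) < 1 - δ := by
      by_contra! hcon
      exact hc ⟨_, hcon⟩
    have h2 := one_le_postProb_add ch enc s (p := fun m' => g m' = g (dec s))
      (q := fun m => m ≠ dec s) fun m => by
        by_cases hm : m = dec s
        · exact Or.inl (by rw [hm])
        · exact Or.inr hm
    have h3 : missProb ch enc τ g δ s ≤ 1 := postProb_le_one ch enc s _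
    have h4 : 1 ≤ 1 / δ * postProb ch enc s (fun m => m ≠ dec s) := by
      rw [one_div, ← div_eq_inv_mul, le_div_iff₀ hδ]
      linarith
    rw [if_pos hτ]
    linarith

variable {dec : List Y → 𝓜} {N : ℕ} {Pe : ℝ}

/-- The probability that the frozen guess of the label is wrong is at most `δ + Pe / δ`. -/
lemma stoppedExp_missProb_le (hδ : 0 < δ)
    (hPe : stoppedExp (predictive ch enc) τ N
      (fun s => if τ s then postProb ch enc s (fun m => m ≠ dec s) else 0) ≤ Pe) :
    stoppedExp (predictive ch enc) (LabelStop ch enc τ g δ) N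
      (fun s => if LabelStop ch enc τ g δ s then missProb ch enc τ g δ s else 0)
        ≤ δ + Pe / δ := by
  have hk := isKernel_predictive ch enc
  set err : List Y → ℝ := fun s => if τ s then postProb ch enc s (fun m => m ≠ dec s) else 0
    with herr
  have herr0 : ∀ s, 0 ≤ err s := fun s => by
    simp only [herr]
    split_ifs
    exacts [postProb_nonneg _ _ _ _, le_rfl]
  have h1 := stoppedExp_mono_of_fresh (σ := LabelStop ch enc τ g δ) hk
    (f := fun s => if LabelStop ch enc τ g δ s then missProb ch enc τ g δ s else 0)
    (g := fun s => δ + 1 / δ * err s) (fun s hs => by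
      split_ifs with h
      · exact missProb_le_of_fresh hδ dec hs h
      · have := herr0 s
        positivity) N
  rw [stoppedExp_add, stoppedExp_const hk, stoppedExp_const_mul] at h1
  have h2 := stoppedExp_le_of_subharmonic (σ := LabelStop ch enc τ g δ) (f := err) hk LabelStop.cons
    (ρ := τ) labelStop_of_stop (fun s _ => by
      by_cases hs : τ s
      · simp [stoppedStep, hs]
      · have : err s = 0 := if_neg hs
        rw [this, stoppedStep, if_neg hs]
        exact Finset.sum_nonneg fun y _ => mul_nonneg (hk.pos s y).le (herr0 _)) N
  have h3 : 1 / δ * stoppedExp (predictive ch enc) (LabelStop ch enc τ g δ) N err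
      ≤ 1 / δ * Pe := mul_le_mul_of_nonneg_left (h2.trans hPe) (by positivity)
  have h4 : 1 / δ * Pe = Pe / δ := by ring
  linarith

lemma stoppedExp_missProb_eq :
    stoppedExp (predictive ch enc) (LabelStop ch enc τ g δ) N
      (fun s => if LabelStop ch enc τ g δ s then missProb ch enc τ g δ s else 0)
    = stoppedExp (predictive ch enc) τ N
      (fun s => if LabelStop ch enc τ g δ s then missProb ch enc τ g δ s else 0) := by
  refine stoppedExp_eq_of_harmonic LabelStop.cons labelStop_of_stop (fun s hs => ?_) N
  by_cases h : τ s
  · simp [stoppedStep, h]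
  · rw [stoppedStep, if_neg h, if_pos hs, ← sum_predictive_mul_missProb hs]
    exact Finset.sum_congr rfl fun y _ => by rw [if_pos (hs.cons s y)]

variable {ε p : ℝ}

/-- Until a label that takes `K` equally likely values is known reliably, the channel has to convey
the information `ln K` up to the loss of Fano's inequality. The inequality compares the output
distributions with and without knowledge of the message. -/
lemma log_card_le_sum_mutualInfo [Fintype X] (hδ : 0 < δ)
    (hPe : stoppedExp (predictive ch enc) τ N
      (fun s => if τ s then postProb ch enc s (fun m => m ≠ dec s) else 0) ≤ Pe)
    (hp : stoppedExp (predictive ch enc) τ N (fun s => if τ s then 0 else 1) ≤ p)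
    (hε0 : 0 < ε) (hε : ε ≤ 1 / 2) (hsum : p + δ + Pe / δ ≤ ε) {K : ℝ} (hK1 : 1 ≤ K)
    (hK : ∀ m, ((Finset.univ.filter fun m' => g m' = g m).card : ℝ) * K = Fintype.card 𝓜) :
    (1 - ε) * Real.log K - Real.binEntropy ε ≤ ∑ n ∈ Finset.range N,
      stoppedExp (predictive ch enc) τ n (fun s =>
        if LabelStop ch enc τ g δ s then 0 else ch.mutualInfo (inputDist ch enc s)) := by
  have hk := isKernel_predictive ch enc
  have hcard : (0 : ℝ) < Fintype.card 𝓜 := by exact_mod_cast Fintype.card_pos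
  set σ := LabelStop ch enc τ g δ with hσ
  set a : ℝ := Real.log ((1 - ε) * K) with ha
  set b : ℝ := Real.log ε with hb
  have hK0 : 0 < K := by linarith
  have hεK : ε ≤ (1 - ε) * K := by nlinarith
  have hab : 0 ≤ a - b := sub_nonneg.2 (Real.log_le_log hε0 hεK)
  set f : 𝓜 → List Y → ℝ := fun m s =>
    if σ s ∧ g m = g (guess ch enc τ g δ s) then a else b with hf
  -- Average the variational inequality over the messages.
  have hDV : ∑ m, 1 / (Fintype.card 𝓜 : ℝ) * stoppedExp (messageKernel ch enc m) σ N (f m)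
      ≤ ∑ m, 1 / (Fintype.card 𝓜 : ℝ) *
        (stoppedExp (predictive ch enc) σ N (fun s => Real.exp (f m s)) - 1 +
        ∑ n ∈ Finset.range N, stoppedExp (messageKernel ch enc m) σ n (fun s =>
          if σ s then 0 else klDiv (messageKernel ch enc m s) (predictive ch enc s))) :=
    Finset.sum_le_sum fun m _ => mul_le_mul_of_nonneg_left
      (stoppedExp_le_add_klDiv (isKernel_messageKernel ch enc m) hk (f m) N) (by positivity)
  rw [average_stoppedExp_messageKernel] at hDV
  simp only [mul_add, mul_sub, Finset.sum_add_distrib, Finset.sum_sub_distrib] at hDV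
  have hone : ∑ _m : 𝓜, 1 / (Fintype.card 𝓜 : ℝ) * 1 = 1 := by
    simp [hcard.ne']
  have hinfo : ∑ m, 1 / (Fintype.card 𝓜 : ℝ) *
        ∑ n ∈ Finset.range N, stoppedExp (messageKernel ch enc m) σ n (fun s =>
          if σ s then 0 else klDiv (messageKernel ch enc m s) (predictive ch enc s))
      = ∑ n ∈ Finset.range N, stoppedExp (predictive ch enc) τ n (fun s =>
        if σ s then 0 else ch.mutualInfo (inputDist ch enc s)) := by
    simp only [Finset.mul_sum]
    rw [Finset.sum_comm]
    refine Finset.sum_congr rfl fun n _ => ?_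
    rw [average_stoppedExp_messageKernel, ← stoppedExp_eq_of_eq_zero (σ := σ) (ρ := τ)
      LabelStop.cons labelStop_of_stop (fun s hs => if_pos hs)]
    congr 1
    funext s
    split_ifs
    · simp
    · rw [mutualInfo_inputDist]
  have hexp : ∑ m, 1 / (Fintype.card 𝓜 : ℝ) *
      stoppedExp (predictive ch enc) σ N (fun s => Real.exp (f m s)) ≤ 1 := by
    simp only [← stoppedExp_const_mul]
    rw [← stoppedExp_sum _ hk]
    refine (stoppedExp_mono hk (g := fun _ => 1) (fun s => ?_) N).trans
      (stoppedExp_const hk 1 N).le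
    have hea : Real.exp a = (1 - ε) * K := Real.exp_log (by linarith)
    have heb : Real.exp b = ε := Real.exp_log hε0
    have h1 : ∀ m, Real.exp (f m s) ≤
        ε + (if g m = g (guess ch enc τ g δ s) then (1 - ε) * K - ε else 0) := by
      intro m
      simp only [hf]
      by_cases h1 : σ s <;> by_cases h2 : g m = g (guess ch enc τ g δ s) <;>
        simp only [h1, h2, hea, heb, and_self, and_false, false_and, if_true, if_false]
      all_goals linarith
    have h2 := hK (guess ch enc τ g δ s)
    calc ∑ m, 1 / (Fintype.card 𝓜 : ℝ) * Real.exp (f m s)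
        ≤ ∑ m, 1 / (Fintype.card 𝓜 : ℝ) *
          (ε + (if g m = g (guess ch enc τ g δ s) then (1 - ε) * K - ε else 0)) :=
          Finset.sum_le_sum fun m _ => mul_le_mul_of_nonneg_left (h1 m) (by positivity)
      _ = 1 / (Fintype.card 𝓜 : ℝ) * (Fintype.card 𝓜 * ε +
          ((Finset.univ.filter fun m' => g m' = g (guess ch enc τ g δ s)).card : ℝ)
            * ((1 - ε) * K - ε)) := by
          rw [← Finset.mul_sum, Finset.sum_add_distrib, ← Finset.sum_filter, Finset.sum_const,
            Finset.sum_const, nsmul_eq_mul, nsmul_eq_mul, Finset.card_univ]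
      _ ≤ 1 / (Fintype.card 𝓜 : ℝ) * Fintype.card 𝓜 := by
          refine mul_le_mul_of_nonneg_left ?_ (by positivity)
          have h3 : (0 : ℝ) ≤
            ((Finset.univ.filter fun m' => g m' = g (guess ch enc τ g δ s)).card : ℝ) :=
            Nat.cast_nonneg _
          nlinarith
      _ = 1 := by field_simp
  -- The left-hand side is determined by the error probability of the guess.
  have hpost : ∀ s, ∑ m, posterior ch enc s m * f m s
      = a + -(a - b) * ((if σ s then missProb ch enc τ g δ s else 0) + if σ s then 0 else 1) := by
    intro s
    by_cases hs : σ s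
    · have h1 : ∀ m, posterior ch enc s m * f m s = a * posterior ch enc s m
          + -(a - b) * (posterior ch enc s m *
            (if g m = g (guess ch enc τ g δ s) then 0 else 1)) := by
        intro m
        by_cases h : g m = g (guess ch enc τ g δ s)
        · simp only [hf, hs, h, and_self, if_true]
          ring
        · simp only [hf, hs, h, and_false, if_false]
          ring
      simp only [h1, Finset.sum_add_distrib, ← Finset.mul_sum, sum_posterior, if_pos hs]
      rw [missProb_eq_sum]
      ring
    · simp [hf, hs, ← Finset.sum_mul, sum_posterior]
  simp only [hpost] at hDV
  rw [stoppedExp_add, stoppedExp_const hk, stoppedExp_const_mul, stoppedExp_add] at hDV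
  have hmiss := stoppedExp_missProb_le (g := g) (dec := dec) hδ hPe
  have htail : stoppedExp (predictive ch enc) σ N (fun s => if σ s then 0 else 1) ≤ p := by
    rw [stoppedExp_eq_of_eq_zero (σ := σ) (ρ := τ)
      LabelStop.cons labelStop_of_stop (fun s hs => if_pos hs)]
    refine (stoppedExp_mono hk (fun s => ?_) N).trans hp
    by_cases h : τ s
    · simp [h, hσ, labelStop_of_stop s h]
    · simp only [h, if_false]
      split_ifs <;> simp
  have hbad := mul_le_mul_of_nonneg_left
    (show _ + _ ≤ ε from (add_le_add hmiss htail).trans (by linarith)) hab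
  have hea : a = Real.log (1 - ε) + Real.log K := Real.log_mul (by linarith) hK0.ne'
  have hent : Real.binEntropy ε = -(ε * b) - (1 - ε) * Real.log (1 - ε) := by
    rw [Real.binEntropy, Real.log_inv, Real.log_inv]
    ring
  have hfin : (1 - ε) * Real.log K - Real.binEntropy ε = a - (a - b) * ε := by
    rw [hent, hea]
    ring
  rw [hfin, ← hinfo]
  rw [hone] at hDV
  linarith

end Label

/-! ### The exponent of the error probability of a label -/

section Exponent

open scoped Classical

variable {X Y 𝓜 β : Type*} [Fintype X] [Fintype Y] [Fintype 𝓜] [Nonempty 𝓜] (ch : Channel X Y)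
  (enc : 𝓜 → List Y → X) (τ : List Y → Prop) (g : 𝓜 → β) (δ : ℝ)

/-- The transition probabilities of the outputs, conditioned, between the freezing of the guess and
decoding, on the event that the guess of the label is wrong. -/
def wrongGuessKernel (s : List Y) (y : Y) : ℝ :=
  if LabelStop ch enc τ g δ s ∧ ¬ τ s then
    predictive ch enc s y * missProb ch enc τ g δ (y :: s) / missProb ch enc τ g δ s
  else predictive ch enc s y

variable {ch enc τ g δ}

/-- The step at which the posterior of the label becomes concentrated leaves an error probability of
at least `λ δ`. -/
lemma minProb_mul_le_missProb {s : List Y} (hs : ¬ LabelStop ch enc τ g δ s) (y : Y) :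
    ch.minProb * δ ≤ missProb ch enc τ g δ (y :: s) := by
  have : Nonempty X := ⟨enc (Classical.arbitrary 𝓜) []⟩
  refine le_trans ?_ (minProb_mul_postProb_le ch enc s y _)
  refine mul_le_mul_of_nonneg_left ?_ ch.minProb_pos.le
  set a := guess ch enc τ g δ (y :: s)
  have h := not_concentrated_of_not_labelStop hs
  have h1 : postProb ch enc s (fun m' => g m' = g a) < 1 - δ := by
    by_contra! hcon
    exact h ⟨_, hcon⟩
  have h2 := postProb_add_not ch enc s (fun m' => g m' = g a)
  change δ ≤ postProb ch enc s (fun m => ¬ g m = g a)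
  linarith

lemma missProb_pos (hδ : 0 < δ) (hroot : ¬ LabelStop ch enc τ g δ []) (s : List Y)
    (hs : LabelStop ch enc τ g δ s) : 0 < missProb ch enc τ g δ s := by
  have : Nonempty X := ⟨enc (Classical.arbitrary 𝓜) []⟩
  induction s with
  | nil => exact absurd hs hroot
  | cons y s ih =>
    by_cases h : LabelStop ch enc τ g δ s
    · refine lt_of_lt_of_le (mul_pos ch.minProb_pos (ih h)) ?_
      simp only [missProb, guess_cons h]
      exact minProb_mul_postProb_le ch enc s y _
    · exact lt_of_lt_of_le (mul_pos ch.minProb_pos hδ) (minProb_mul_le_missProb h y)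

lemma isKernel_wrongGuessKernel (hδ : 0 < δ) (hroot : ¬ LabelStop ch enc τ g δ []) :
    IsKernel (wrongGuessKernel ch enc τ g δ) := by
  have hk := isKernel_predictive ch enc
  constructor
  · intro s y
    unfold wrongGuessKernel
    split_ifs with h
    · exact div_pos (mul_pos (hk.pos s y) (missProb_pos hδ hroot _ (h.1.cons s y)))
        (missProb_pos hδ hroot _ h.1)
    · exact hk.pos s y
  · intro s
    unfold wrongGuessKernel
    split_ifs with h
    · rw [← Finset.sum_div, sum_predictive_mul_missProb h.1]
      exact div_self (missProb_pos hδ hroot _ h.1).ne'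
    · exact hk.sum_eq_one s

/-- Knowing that the guess is wrong leaves a mixture of rows of the channel, so that one row is at
least as far from the unconditional output distribution. -/
lemma klDiv_wrongGuessKernel_le (hδ : 0 < δ) (hroot : ¬ LabelStop ch enc τ g δ []) (s : List Y) :
    klDiv (predictive ch enc s) (wrongGuessKernel ch enc τ g δ s)
      ≤ if LabelStop ch enc τ g δ s ∧ ¬ τ s then ch.maxDivFrom (inputDist ch enc s) else 0 := by
  have hk := isKernel_predictive ch enc
  split_ifs with h
  · have hpos := missProb_pos hδ hroot _ h.1
    set a : 𝓜 → ℝ := fun m => posterior ch enc s m *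
      (if g m = g (guess ch enc τ g δ s) then 0 else 1) / missProb ch enc τ g δ s with ha
    have ha0 : ∀ m, 0 ≤ a m := fun m => div_nonneg
      (mul_nonneg (posterior_pos ch enc s m).le (by split_ifs <;> simp)) hpos.le
    have ha1 : ∑ m, a m = 1 := by
      rw [← Finset.sum_div, ← missProb_eq_sum]
      exact div_self hpos.ne'
    have hmix : wrongGuessKernel ch enc τ g δ s
        = fun y => ∑ m, a m * messageKernel ch enc m s y := by
      funext y
      rw [wrongGuessKernel, if_pos h, missProb_eq_sum (y :: s), guess_cons h.1, Finset.mul_sum,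
        Finset.sum_div]
      refine Finset.sum_congr rfl fun m _ => ?_
      rw [← mul_assoc, predictive_mul_posterior]
      simp only [ha]
      ring
    rw [hmix]
    refine (klDiv_mixture_right_le (hk.pos s) ha0 ha1 fun m y => ch.pos _ y).trans ?_
    calc ∑ m, a m * klDiv (predictive ch enc s) (messageKernel ch enc m s)
        ≤ ∑ m, a m * ch.maxDivFrom (inputDist ch enc s) := by
          refine Finset.sum_le_sum fun m _ => mul_le_mul_of_nonneg_left ?_ (ha0 m)
          rw [← outDist_inputDist]
          exact ch.klDiv_le_maxDivFrom _ (enc m s)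
      _ = _ := by rw [← Finset.sum_mul, ha1, one_mul]
  · refine le_of_eq ?_
    have : wrongGuessKernel ch enc τ g δ s = predictive ch enc s := by
      funext y
      rw [wrongGuessKernel, if_neg h]
    rw [this]
    unfold klDiv
    exact Finset.sum_eq_zero fun y _ => by rw [div_self (hk.pos s y).ne', Real.log_one, mul_zero]

/-- Change of measure: the conditioning on a wrong guess costs at most the factor `1 / (λ δ)`. -/
lemma stoppedExp_wrongGuessKernel_le (hδ : 0 < δ) (hroot : ¬ LabelStop ch enc τ g δ [])
    {f : List Y → ℝ} (hf : ∀ s, 0 ≤ f s) (n : ℕ) :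
    stoppedExp (wrongGuessKernel ch enc τ g δ) τ n f ≤
      stoppedExp (predictive ch enc) τ n (fun s => (if LabelStop ch enc τ g δ s then
        missProb ch enc τ g δ s / (ch.minProb * δ) else 1) * f s) := by
  have : Nonempty X := ⟨enc (Classical.arbitrary 𝓜) []⟩
  have hk := isKernel_predictive ch enc
  have hk' := isKernel_wrongGuessKernel hδ hroot
  have hld : 0 < ch.minProb * δ := mul_pos ch.minProb_pos hδ
  induction n generalizing f with
  | zero => simp [stoppedExp, hroot]
  | succ n ih =>
    have hstep : ∀ s, 0 ≤ stoppedStep (wrongGuessKernel ch enc τ g δ) τ f s := by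
      intro s
      unfold stoppedStep
      split_ifs
      exacts [hf s, Finset.sum_nonneg fun y _ => mul_nonneg (hk'.pos s y).le (hf _)]
    refine (ih hstep).trans (stoppedExp_mono hk (fun s => ?_) n)
    by_cases hs : τ s
    · simp [stoppedStep, hs]
    rw [stoppedStep, if_neg hs, stoppedStep, if_neg hs, Finset.mul_sum]
    refine Finset.sum_le_sum fun y _ => ?_
    by_cases hσ : LabelStop ch enc τ g δ s
    · have hm := (missProb_pos hδ hroot _ hσ).ne'
      rw [if_pos hσ, if_pos (hσ.cons s y), wrongGuessKernel, if_pos ⟨hσ, hs⟩]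
      refine le_of_eq ?_
      field_simp
    · rw [if_neg hσ, wrongGuessKernel, if_neg (fun h => hσ h.1), one_mul]
      refine mul_le_mul_of_nonneg_left ?_ (hk.pos s y).le
      refine le_mul_of_one_le_left (hf _) ?_
      split_ifs
      · rw [le_div_iff₀ hld, one_mul]
        exact minProb_mul_le_missProb hσ y
      · exact le_rfl

variable {dec : List Y → 𝓜} {N : ℕ} {Pe p ε e : ℝ}

/-- After the guess of the label is frozen, the divergence that the channel can build up between the
hypotheses that the guess is right or wrong bounds the exponent of the error probability. -/
lemma neg_log_errProb_le_sum_maxDivFrom (hδ : 0 < δ) (hδ1 : δ ≤ 1)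
    (hroot : ¬ LabelStop ch enc τ g δ [])
    (hPe : stoppedExp (predictive ch enc) τ N
      (fun s => if τ s then postProb ch enc s (fun m => m ≠ dec s) else 0) ≤ Pe)
    (hp : stoppedExp (predictive ch enc) τ N (fun s => if τ s then 0 else 1) ≤ p)
    (he0 : 0 < e)
    (he : stoppedExp (predictive ch enc) τ N
      (fun s => if τ s then postProb ch enc s (fun m => g m ≠ g (dec s)) else 0) ≤ e)
    (hε0 : 0 < ε) (hε : ε ≤ 1 / 2) (hsum : p + Pe + δ + Pe / δ ≤ ε) :
    (1 - ε) * -Real.log e - (Real.binEntropy ε - Real.log (ch.minProb * δ)) ≤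
      ∑ n ∈ Finset.range N, stoppedExp (predictive ch enc) τ n (fun s =>
        if LabelStop ch enc τ g δ s ∧ ¬ τ s then ch.maxDivFrom (inputDist ch enc s) else 0) := by
  have : Nonempty X := ⟨enc (Classical.arbitrary 𝓜) []⟩
  have hk := isKernel_predictive ch enc
  have hk' := isKernel_wrongGuessKernel hδ hroot
  have hld : 0 < ch.minProb * δ := mul_pos ch.minProb_pos hδ
  have hld1 : ch.minProb * δ ≤ 1 := mul_le_one₀ ch.minProb_le_one hδ.le hδ1
  have hlog : Real.log (ch.minProb * δ) ≤ 0 := Real.log_nonpos hld.le hld1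
  set S := ∑ n ∈ Finset.range N, stoppedExp (predictive ch enc) τ n (fun s =>
        if LabelStop ch enc τ g δ s ∧ ¬ τ s then ch.maxDivFrom (inputDist ch enc s) else 0) with hS
  have hS0 : 0 ≤ S := Finset.sum_nonneg fun n _ => stoppedExp_nonneg hk (fun s => by
    split_ifs
    exacts [ch.maxDivFrom_nonneg (inputDist_mem ch enc s), le_rfl]) n
  have hh : 0 ≤ Real.binEntropy ε := Real.binEntropy_nonneg hε0.le (by linarith)
  -- If `e > λ δ`, the left-hand side is not positive.
  rcases lt_or_ge (ch.minProb * δ) e with hq | hq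
  · have h1 := Real.log_le_log hld hq.le
    nlinarith
  set q := e / (ch.minProb * δ) with hqdef
  have hq0 : 0 < q := div_pos he0 hld
  have hq1 : q ≤ 1 := (div_le_one hld).2 hq
  set G : List Y → Prop := fun s => τ s ∧ g (dec s) = g (guess ch enc τ g δ s) with hG
  set a : ℝ := Real.log ((1 - ε) / q) with ha
  set b : ℝ := Real.log ε with hb
  have hε1 : 0 < 1 - ε := by linarith
  have hab : 0 ≤ a - b := by
    refine sub_nonneg.2 (Real.log_le_log hε0 ?_)
    rw [le_div_iff₀ hq0]
    nlinarith
  have hDV := stoppedExp_le_add_klDiv (σ := τ) hk hk' (fun s => b + (a - b) * if G s then 1 else 0) N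
  rw [stoppedExp_add, stoppedExp_const hk, stoppedExp_const_mul] at hDV
  -- Under the alternative measure the decision agrees with the guess with probability at most `q`.
  have hQ : stoppedExp (wrongGuessKernel ch enc τ g δ) τ N (fun s => if G s then 1 else 0) ≤ q := by
    refine (stoppedExp_wrongGuessKernel_le hδ hroot (fun s => by split_ifs <;> simp) N).trans ?_
    have h1 : ∀ s, (if LabelStop ch enc τ g δ s then
        missProb ch enc τ g δ s / (ch.minProb * δ) else 1) * (if G s then (1 : ℝ) else 0)
        ≤ 1 / (ch.minProb * δ) *
          (if τ s then postProb ch enc s (fun m => g m ≠ g (dec s)) else 0) := by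
      intro s
      by_cases h : G s
      · rw [if_pos h, if_pos h.1, if_pos (labelStop_of_stop s h.1), missProb, ← h.2]
        exact le_of_eq (by ring)
      · rw [if_neg h, mul_zero]
        split_ifs
        · exact mul_nonneg (by positivity) (postProb_nonneg _ _ _ _)
        · simp
    refine (stoppedExp_mono hk h1 N).trans ?_
    rw [stoppedExp_const_mul, hqdef, one_div, div_eq_inv_mul]
    exact mul_le_mul_of_nonneg_left he (by positivity)
  have hexp : stoppedExp (wrongGuessKernel ch enc τ g δ) τ N
      (fun s => Real.exp (b + (a - b) * if G s then 1 else 0)) ≤ 1 := by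
    have h1 : ∀ s, Real.exp (b + (a - b) * if G s then 1 else 0)
        ≤ ε + (1 - ε) / q * if G s then 1 else 0 := by
      intro s
      have hea : Real.exp a = (1 - ε) / q := Real.exp_log (by positivity)
      have heb : Real.exp b = ε := Real.exp_log hε0
      split_ifs
      · rw [mul_one, mul_one, add_sub_cancel, hea]
        linarith
      · simp [heb]
    refine (stoppedExp_mono hk' h1 N).trans ?_
    rw [stoppedExp_add, stoppedExp_const hk', stoppedExp_const_mul]
    have h2 := mul_le_mul_of_nonneg_left hQ (show 0 ≤ (1 - ε) / q by positivity)
    rw [div_mul_cancel₀ _ hq0.ne'] at h2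
    linarith
  -- Under the true measure they agree with probability at least `1 - ε`.
  have hP : 1 - ε ≤ stoppedExp (predictive ch enc) τ N (fun s => if G s then 1 else 0) := by
    have hmiss := stoppedExp_missProb_le (g := g) (dec := dec) hδ hPe
    rw [stoppedExp_missProb_eq] at hmiss
    have h1 : ∀ s, (1 : ℝ) ≤ (((if G s then 1 else 0) + (if τ s then 0 else 1)) +
        (if τ s then postProb ch enc s (fun m => m ≠ dec s) else 0)) +
        (if LabelStop ch enc τ g δ s then missProb ch enc τ g δ s else 0) := by
      intro s
      by_cases hs : τ s
      · rw [if_pos hs, if_pos hs, if_pos (labelStop_of_stop s hs)]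
        have h0 : 0 ≤ missProb ch enc τ g δ s := missProb_nonneg s
        have h0' := postProb_nonneg ch enc s (fun m => m ≠ dec s)
        by_cases h : g (dec s) = g (guess ch enc τ g δ s)
        · rw [if_pos (show G s from ⟨hs, h⟩)]
          linarith
        · rw [if_neg (show ¬ G s from fun h' => h h'.2)]
          have := one_le_postProb_add ch enc s (p := fun m => m ≠ dec s)
            (q := fun m => g m ≠ g (guess ch enc τ g δ s)) fun m => by
              by_cases hm : m = dec s
              · exact Or.inr (by rw [hm]; exact h)
              · exact Or.inl hm
          unfold missProb
          linarith
      · rw [if_neg hs, if_neg hs]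
        have h0 : (0 : ℝ) ≤ if LabelStop ch enc τ g δ s then missProb ch enc τ g δ s else 0 := by
          split_ifs
          exacts [missProb_nonneg s, le_rfl]
        have h0' : (0 : ℝ) ≤ if G s then 1 else 0 := by split_ifs <;> simp
        linarith
    have h2 := stoppedExp_mono (σ := τ) hk h1 N
    rw [stoppedExp_const hk, stoppedExp_add, stoppedExp_add, stoppedExp_add] at h2
    linarith
  have hKL : ∑ n ∈ Finset.range N, stoppedExp (predictive ch enc) τ n (fun s =>
      if τ s then 0 else klDiv (predictive ch enc s) (wrongGuessKernel ch enc τ g δ s)) ≤ S := by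
    refine Finset.sum_le_sum fun n _ => stoppedExp_mono hk (fun s => ?_) n
    by_cases hs : τ s
    · simp [hs]
    · rw [if_neg hs]
      exact klDiv_wrongGuessKernel_le hδ hroot s
  have hPab := mul_le_mul_of_nonneg_left hP hab
  have hea : a = Real.log (1 - ε) - (Real.log e - Real.log (ch.minProb * δ)) := by
    rw [ha, Real.log_div hε1.ne' hq0.ne', hqdef, Real.log_div he0.ne' hld.ne']
  have hent : Real.binEntropy ε = -(ε * b) - (1 - ε) * Real.log (1 - ε) := by
    rw [Real.binEntropy, Real.log_inv, Real.log_inv]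
    ring
  have hfin : (1 - ε) * -Real.log e - (Real.binEntropy ε - (1 - ε) * Real.log (ch.minProb * δ))
      = b + (a - b) * (1 - ε) := by
    rw [hent, hea]
    ring
  have hfin2 : Real.log (ch.minProb * δ) ≤ (1 - ε) * Real.log (ch.minProb * δ) := by nlinarith
  linarith

end Exponent

/-! ### Time sharing and the function `J` -/

section TimeSharing

/-- A weighted sum of three points of the plane, one of whose abscissae lies between the other two,
is dominated by a weighted sum of two of them with the same total weight. -/
lemma exists_two_point_dominating_of_between {S : Set (ℝ × ℝ)} {p₁ p₂ p₃ : ℝ × ℝ}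
    (h₁ : p₁ ∈ S) (h₂ : p₂ ∈ S) (h₃ : p₃ ∈ S) {w₁ w₂ w₃ : ℝ} (hw₁ : 0 ≤ w₁) (hw₂ : 0 ≤ w₂)
    (hw₃ : 0 ≤ w₃) (h12 : p₁.1 ≤ p₂.1) (h23 : p₂.1 ≤ p₃.1) :
    ∃ a ∈ S, ∃ b ∈ S, ∃ u v : ℝ, 0 ≤ u ∧ 0 ≤ v ∧ u + v = w₁ + w₂ + w₃ ∧
      w₁ * p₁.1 + w₂ * p₂.1 + w₃ * p₃.1 ≤ u * a.1 + v * b.1 ∧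
      w₁ * p₁.2 + w₂ * p₂.2 + w₃ * p₃.2 ≤ u * a.2 + v * b.2 := by
  obtain ⟨α, h0, h1, hα⟩ : ∃ α : ℝ, 0 ≤ α ∧ α ≤ 1 ∧ p₂.1 = α * p₁.1 + (1 - α) * p₃.1 := by
    rcases eq_or_lt_of_le (h12.trans h23) with h | h
    · exact ⟨0, le_rfl, zero_le_one, by linarith⟩
    · have hd : 0 < p₃.1 - p₁.1 := by linarith
      refine ⟨(p₃.1 - p₂.1) / (p₃.1 - p₁.1), div_nonneg (by linarith) hd.le,
        (div_le_one hd).2 (by linarith), ?_⟩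
      field_simp
      ring
  rcases le_or_gt p₂.2 (α * p₁.2 + (1 - α) * p₃.2) with hc | hc
  · -- The middle point lies below the chord: split its weight between the outer points.
    refine ⟨p₁, h₁, p₃, h₃, w₁ + α * w₂, w₃ + (1 - α) * w₂, by positivity,
      add_nonneg hw₃ (mul_nonneg (by linarith) hw₂), by ring, ?_, ?_⟩
    · rw [hα]
      exact le_of_eq (by ring)
    · nlinarith [mul_le_mul_of_nonneg_left hc hw₂]
  · -- It lies above the chord: shift weight to it until an outer point is used up.
    rcases le_or_gt (w₁ * (1 - α)) (w₃ * α) with hw | hw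
    · rcases eq_or_lt_of_le h0 with hz | hz
      · have hw₁' : w₁ = 0 := by
          rw [← hz] at hw
          linarith
        exact ⟨p₂, h₂, p₃, h₃, w₂, w₃, hw₂, hw₃, by rw [hw₁']; ring,
          by rw [hw₁']; exact le_of_eq (by ring), by rw [hw₁']; exact le_of_eq (by ring)⟩
      · have hs : 0 ≤ w₁ / α := div_nonneg hw₁ h0
        have hsα : w₁ / α * α = w₁ := div_mul_cancel₀ _ hz.ne'
        refine ⟨p₂, h₂, p₃, h₃, w₂ + w₁ / α, w₃ - (1 - α) * (w₁ / α), by positivity, ?_, ?_, ?_, ?_⟩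
        · rw [sub_nonneg, ← mul_div_assoc, div_le_iff₀ hz]
          linarith
        · linear_combination hsα
        · refine le_of_eq ?_
          linear_combination (-(w₁ / α)) * hα - p₁.1 * hsα
        · have := mul_le_mul_of_nonneg_left hc.le hs
          have e : w₁ / α * (α * p₁.2) = w₁ * p₁.2 := by rw [← mul_assoc, hsα]
          nlinarith
    · have hz : 0 < 1 - α := by
        by_contra! hcon
        nlinarith
      have hs : 0 ≤ w₃ / (1 - α) := div_nonneg hw₃ hz.le
      have hsα : w₃ / (1 - α) * (1 - α) = w₃ := div_mul_cancel₀ _ hz.ne'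
      refine ⟨p₁, h₁, p₂, h₂, w₁ - α * (w₃ / (1 - α)), w₂ + w₃ / (1 - α), ?_, by positivity,
        ?_, ?_, ?_⟩
      · rw [sub_nonneg, ← mul_div_assoc, div_le_iff₀ hz]
        linarith
      · linear_combination hsα
      · refine le_of_eq ?_
        linear_combination (-(w₃ / (1 - α))) * hα - p₃.1 * hsα
      · have := mul_le_mul_of_nonneg_left hc.le hs
        have e : w₃ / (1 - α) * ((1 - α) * p₃.2) = w₃ * p₃.2 := by rw [← mul_assoc, hsα]
        nlinarith

/-- The case of Carathéodory's theorem that makes two input distributions enough in the definition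
of `J`. -/
lemma exists_two_point_dominating {S : Set (ℝ × ℝ)} {p₁ p₂ p₃ : ℝ × ℝ}
    (h₁ : p₁ ∈ S) (h₂ : p₂ ∈ S) (h₃ : p₃ ∈ S) {w₁ w₂ w₃ : ℝ} (hw₁ : 0 ≤ w₁) (hw₂ : 0 ≤ w₂)
    (hw₃ : 0 ≤ w₃) :
    ∃ a ∈ S, ∃ b ∈ S, ∃ u v : ℝ, 0 ≤ u ∧ 0 ≤ v ∧ u + v = w₁ + w₂ + w₃ ∧
      w₁ * p₁.1 + w₂ * p₂.1 + w₃ * p₃.1 ≤ u * a.1 + v * b.1 ∧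
      w₁ * p₁.2 + w₂ * p₂.2 + w₃ * p₃.2 ≤ u * a.2 + v * b.2 := by
  rcases le_total p₁.1 p₂.1 with h12 | h12 <;> rcases le_total p₂.1 p₃.1 with h23 | h23 <;>
    rcases le_total p₁.1 p₃.1 with h13 | h13
  · exact exists_two_point_dominating_of_between h₁ h₂ h₃ hw₁ hw₂ hw₃ h12 h23
  · exact exists_two_point_dominating_of_between h₁ h₂ h₃ hw₁ hw₂ hw₃ h12 h23
  · obtain ⟨a, ha, b, hb, u, v, hu, hv, h, h', h''⟩ :=
      exists_two_point_dominating_of_between h₁ h₃ h₂ hw₁ hw₃ hw₂ h13 h23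
    exact ⟨a, ha, b, hb, u, v, hu, hv, by linarith, by linarith, by linarith⟩
  · obtain ⟨a, ha, b, hb, u, v, hu, hv, h, h', h''⟩ :=
      exists_two_point_dominating_of_between h₃ h₁ h₂ hw₃ hw₁ hw₂ h13 h12
    exact ⟨a, ha, b, hb, u, v, hu, hv, by linarith, by linarith, by linarith⟩
  · obtain ⟨a, ha, b, hb, u, v, hu, hv, h, h', h''⟩ :=
      exists_two_point_dominating_of_between h₂ h₁ h₃ hw₂ hw₁ hw₃ h12 h13
    exact ⟨a, ha, b, hb, u, v, hu, hv, by linarith, by linarith, by linarith⟩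
  · obtain ⟨a, ha, b, hb, u, v, hu, hv, h, h', h''⟩ :=
      exists_two_point_dominating_of_between h₂ h₃ h₁ hw₂ hw₃ hw₁ h23 h13
    exact ⟨a, ha, b, hb, u, v, hu, hv, by linarith, by linarith, by linarith⟩
  · obtain ⟨a, ha, b, hb, u, v, hu, hv, h, h', h''⟩ :=
      exists_two_point_dominating_of_between h₃ h₂ h₁ hw₃ hw₂ hw₁ h23 h12
    exact ⟨a, ha, b, hb, u, v, hu, hv, by linarith, by linarith, by linarith⟩
  · obtain ⟨a, ha, b, hb, u, v, hu, hv, h, h', h''⟩ :=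
      exists_two_point_dominating_of_between h₃ h₂ h₁ hw₃ hw₂ hw₁ h23 h12
    exact ⟨a, ha, b, hb, u, v, hu, hv, by linarith, by linarith, by linarith⟩

variable {X Y : Type*} [Fintype X] [Fintype Y]

/-- The pairs of the mutual information and the divergence from a row of the channel that a single
input distribution provides. -/
def infoDivPairs (ch : Channel X Y) : Set (ℝ × ℝ) :=
  ⋃ x, (fun φ => (ch.mutualInfo φ, klDiv (ch.outDist φ) (ch.W x))) '' stdSimplex ℝ X

lemma isCompact_infoDivPairs (ch : Channel X Y) : IsCompact (infoDivPairs ch) :=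
  isCompact_iUnion fun x => (isCompact_stdSimplex ℝ X).image_of_continuousOn
    (ch.continuousOn_mutualInfo.prodMk (ch.continuousOn_klDiv_outDist x))

lemma infoDivPairs_bounds {ch : Channel X Y} {p : ℝ × ℝ} (hp : p ∈ infoDivPairs ch) :
    p.1 ≤ ch.capacity ∧ 0 ≤ p.2 := by
  simp only [infoDivPairs, Set.mem_iUnion, Set.mem_image] at hp
  obtain ⟨x, φ, hφ, rfl⟩ := hp
  exact ⟨ch.mutualInfo_le_capacity hφ, klDiv_nonneg (ch.outDist_pos hφ) (ch.pos x)
    (ch.sum_outDist hφ) (ch.sum_eq_one x)⟩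

/-- Within the time `t` the channel can convey the information `I` and at the same time build up the
divergence `B`, by sharing the time between two input distributions. -/
def Achievable (ch : Channel X Y) (t I B : ℝ) : Prop :=
  ∃ a ∈ infoDivPairs ch, ∃ b ∈ infoDivPairs ch, ∃ u v : ℝ, 0 ≤ u ∧ 0 ≤ v ∧ u + v = t ∧
    I ≤ u * a.1 + v * b.1 ∧ B ≤ u * a.2 + v * b.2

variable {ch : Channel X Y} {t I B t' I' B' : ℝ}

lemma infoDivPairs_nonempty [Nonempty X] : (infoDivPairs ch).Nonempty := by
  classical
  let x : X := Classical.arbitrary X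
  exact ⟨_, Set.mem_iUnion.2 ⟨x, Set.mem_image_of_mem _ (single_mem_stdSimplex ℝ x)⟩⟩

lemma Achievable.time_nonneg (h : Achievable ch t I B) : 0 ≤ t := by
  obtain ⟨a, -, b, -, u, v, hu, hv, rfl, -⟩ := h
  positivity

lemma Achievable.info_le (h : Achievable ch t I B) : I ≤ ch.capacity * t := by
  obtain ⟨a, ha, b, hb, u, v, hu, hv, rfl, hI, -⟩ := h
  nlinarith [mul_le_mul_of_nonneg_left (infoDivPairs_bounds ha).1 hu,
    mul_le_mul_of_nonneg_left (infoDivPairs_bounds hb).1 hv]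

lemma achievable_zero [Nonempty X] : Achievable ch 0 0 0 := by
  obtain ⟨a, ha⟩ := infoDivPairs_nonempty (ch := ch)
  exact ⟨a, ha, a, ha, 0, 0, le_rfl, le_rfl, by simp, by simp, by simp⟩

lemma Achievable.smul {c : ℝ} (hc : 0 ≤ c) (h : Achievable ch t I B) :
    Achievable ch (c * t) (c * I) (c * B) := by
  obtain ⟨a, ha, b, hb, u, v, hu, hv, rfl, hI, hB⟩ := h
  refine ⟨a, ha, b, hb, c * u, c * v, by positivity, by positivity, by ring, ?_, ?_⟩
  · nlinarith [mul_le_mul_of_nonneg_left hI hc]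
  · nlinarith [mul_le_mul_of_nonneg_left hB hc]

lemma Achievable.add (h : Achievable ch t I B) (h' : Achievable ch t' I' B') :
    Achievable ch (t + t') (I + I') (B + B') := by
  obtain ⟨a, ha, b, hb, u, v, hu, hv, rfl, hI, hB⟩ := h
  obtain ⟨a', ha', b', hb', u', v', hu', hv', rfl, hI', hB'⟩ := h'
  obtain ⟨c, hc, d, hd, p, q, hp, hq, e1, e2, e3⟩ :=
    exists_two_point_dominating ha hb ha' hu hv hu'
  obtain ⟨c', hc', d', hd', p', q', hp', hq', f1, f2, f3⟩ :=
    exists_two_point_dominating hc hd hb' hp hq hv'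
  exact ⟨c', hc', d', hd', p', q', hp', hq', by linarith, by linarith, by linarith⟩

lemma achievable_one [Nonempty X] {φ : X → ℝ} (hφ : φ ∈ stdSimplex ℝ X) :
    Achievable ch 1 (ch.mutualInfo φ) (ch.maxDivFrom φ) := by
  obtain ⟨x, hx⟩ := exists_eq_ciSup_of_finite (f := fun x => klDiv (ch.outDist φ) (ch.W x))
  have h : (ch.mutualInfo φ, ch.maxDivFrom φ) ∈ infoDivPairs ch := by
    rw [Channel.maxDivFrom, ← hx]
    exact Set.mem_iUnion.2 ⟨x, Set.mem_image_of_mem _ hφ⟩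
  exact ⟨_, h, _, h, 1, 0, zero_le_one, le_rfl, by simp, by simp, by simp⟩

lemma Achievable.div_le_J (h : Achievable ch t I B) (ht : 0 < t) {r : ℝ} (hr : r ≤ I) :
    B ≤ t * ch.J (r / t) := by
  obtain ⟨a, ha, b, hb, u, v, hu, hv, rfl, hI, hB⟩ := h
  simp only [infoDivPairs, Set.mem_iUnion, Set.mem_image] at ha hb
  obtain ⟨x₁, φ₁, hφ₁, rfl⟩ := ha
  obtain ⟨x₂, φ₂, hφ₂, rfl⟩ := hb
  dsimp only at hI hB
  have hα : 1 - u / (u + v) = v / (u + v) := by field_simp; ring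
  have hle : u / (u + v) * klDiv (ch.outDist φ₁) (ch.W x₁)
      + (1 - u / (u + v)) * klDiv (ch.outDist φ₂) (ch.W x₂) ≤ ch.J (r / (u + v)) := by
    refine le_csSup ⟨ch.maxDiv, ?_⟩ ⟨u / (u + v), ⟨by positivity, ?_⟩, x₁, x₂, φ₁, hφ₁, φ₂, hφ₂,
      ?_, rfl⟩
    · rintro w ⟨α, hα, y₁, y₂, ψ₁, hψ₁, ψ₂, hψ₂, -, rfl⟩
      nlinarith [mul_le_mul_of_nonneg_left (ch.klDiv_outDist_le_maxDiv hψ₁ y₁) hα.1,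
        mul_le_mul_of_nonneg_left (ch.klDiv_outDist_le_maxDiv hψ₂ y₂) (sub_nonneg.2 hα.2)]
    · rw [div_le_one ht]
      linarith
    · rw [hα, div_mul_eq_mul_div, div_mul_eq_mul_div, ← add_div]
      gcongr
      exact hr.trans hI
  refine hB.trans ?_
  have h2 := mul_le_mul_of_nonneg_left hle ht.le
  rw [hα] at h2
  refine le_trans (le_of_eq ?_) h2
  field_simp

/-- Uniformly bounded sequences of achievable triples have achievable limit points, up to raising
the information and the divergence. -/
lemma exists_subseq_achievable {T : ℝ} (t I B : ℕ → ℕ → ℝ)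
    (h : ∀ n j, Achievable ch (t n j) (I n j) (B n j)) (hT : ∀ n j, t n j ≤ T) :
    ∃ (t₀ I₀ B₀ : ℕ → ℝ) (I' B' : ℕ → ℕ → ℝ) (ns : ℕ → ℕ), StrictMono ns ∧
      (∀ j, Achievable ch (t₀ j) (I₀ j) (B₀ j)) ∧ (∀ j, 0 ≤ B₀ j) ∧
      (∀ n j, I (ns n) j ≤ I' n j) ∧ (∀ n j, B (ns n) j ≤ B' n j) ∧
      (∀ j, Filter.Tendsto (fun n => t (ns n) j) Filter.atTop (nhds (t₀ j))) ∧
      (∀ j, Filter.Tendsto (fun n => I' n j) Filter.atTop (nhds (I₀ j))) ∧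
      (∀ j, Filter.Tendsto (fun n => B' n j) Filter.atTop (nhds (B₀ j))) := by
  choose a ha b hb u v hu hv huv hI hB using h
  have hcomp : IsCompact (Set.univ.pi fun _ : ℕ =>
      infoDivPairs ch ×ˢ infoDivPairs ch ×ˢ Set.Icc 0 T ×ˢ Set.Icc 0 T) :=
    isCompact_univ_pi fun _ => (isCompact_infoDivPairs ch).prod
      ((isCompact_infoDivPairs ch).prod (isCompact_Icc.prod isCompact_Icc))
  have hmem : ∀ n, (fun j => (a n j, b n j, u n j, v n j)) ∈ Set.univ.pi fun _ : ℕ =>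
      infoDivPairs ch ×ˢ infoDivPairs ch ×ˢ Set.Icc 0 T ×ˢ Set.Icc 0 T := by
    intro n j _
    have h1 := huv n j
    have h2 := hT n j
    have h3 := hu n j
    have h4 := hv n j
    exact ⟨ha n j, hb n j, ⟨h3, by linarith⟩, ⟨h4, by linarith⟩⟩
  obtain ⟨x, hx, ns, hns, hlim⟩ := hcomp.tendsto_subseq hmem
  have hlimj := fun j => (tendsto_pi_nhds.1 hlim j)
  have la : ∀ j, Filter.Tendsto (fun n => a (ns n) j) Filter.atTop (nhds (x j).1) := fun j =>
    (continuous_fst.tendsto _).comp (hlimj j)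
  have lb : ∀ j, Filter.Tendsto (fun n => b (ns n) j) Filter.atTop (nhds (x j).2.1) := fun j =>
    ((continuous_fst.comp continuous_snd).tendsto _).comp (hlimj j)
  have lu : ∀ j, Filter.Tendsto (fun n => u (ns n) j) Filter.atTop (nhds (x j).2.2.1) := fun j =>
    ((continuous_fst.comp (continuous_snd.comp continuous_snd)).tendsto _).comp (hlimj j)
  have lv : ∀ j, Filter.Tendsto (fun n => v (ns n) j) Filter.atTop (nhds (x j).2.2.2) := fun j =>
    ((continuous_snd.comp (continuous_snd.comp continuous_snd)).tendsto _).comp (hlimj j)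
  have fst_lim {f : ℕ → ℝ × ℝ} {y : ℝ × ℝ} (hf : Filter.Tendsto f Filter.atTop (nhds y)) :
      Filter.Tendsto (fun n => (f n).1) Filter.atTop (nhds y.1) :=
    (continuous_fst.tendsto _).comp hf
  have snd_lim {f : ℕ → ℝ × ℝ} {y : ℝ × ℝ} (hf : Filter.Tendsto f Filter.atTop (nhds y)) :
      Filter.Tendsto (fun n => (f n).2) Filter.atTop (nhds y.2) :=
    (continuous_snd.tendsto _).comp hf
  refine ⟨fun j => (x j).2.2.1 + (x j).2.2.2,
    fun j => (x j).2.2.1 * (x j).1.1 + (x j).2.2.2 * (x j).2.1.1,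
    fun j => (x j).2.2.1 * (x j).1.2 + (x j).2.2.2 * (x j).2.1.2,
    fun n j => u (ns n) j * (a (ns n) j).1 + v (ns n) j * (b (ns n) j).1,
    fun n j => u (ns n) j * (a (ns n) j).2 + v (ns n) j * (b (ns n) j).2, ns, hns,
    fun j => ?_, fun j => ?_, fun n j => hI _ _, fun n j => hB _ _, fun j => ?_, fun j => ?_,
    fun j => ?_⟩
  · obtain ⟨hxa, hxb, hxu, hxv⟩ := hx j trivial
    exact ⟨_, hxa, _, hxb, _, _, hxu.1, hxv.1, rfl, le_rfl, le_rfl⟩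
  · obtain ⟨hxa, hxb, hxu, hxv⟩ := hx j trivial
    exact add_nonneg (mul_nonneg hxu.1 (infoDivPairs_bounds hxa).2)
      (mul_nonneg hxv.1 (infoDivPairs_bounds hxb).2)
  · simpa only [huv] using (lu j).add (lv j)
  · exact ((lu j).mul (fst_lim (la j))).add ((lv j).mul (fst_lim (lb j)))
  · exact ((lu j).mul (snd_lim (la j))).add ((lv j).mul (snd_lim (lb j)))

/-- If the information conveyed up to the end of each phase suffices for the demands `r` of the
phases so far, then surplus time can be handed on to later phases so that every phase meets its own
demand; this does not decrease the divergence built up from any phase on. -/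
lemma exists_redistribution (ℓ : ℕ) (t I B r : ℕ → ℝ)
    (h : ∀ j, Achievable ch (t j) (I j) (B j)) (hB : ∀ j, 0 ≤ B j) (hr : ∀ j, 0 ≤ r j)
    (hcum : ∀ i ≤ ℓ, ∑ j ∈ Finset.range i, r j ≤ ∑ j ∈ Finset.range i, I j) :
    ∃ t' I' B' : ℕ → ℝ, (∀ j, Achievable ch (t' j) (I' j) (B' j)) ∧ (∀ j < ℓ, r j ≤ I' j) ∧
      ∑ j ∈ Finset.range ℓ, t' j = ∑ j ∈ Finset.range ℓ, t j ∧
      ∀ i, ∑ j ∈ Finset.range ℓ, (if i ≤ j then B j else 0)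
        ≤ ∑ j ∈ Finset.range ℓ, (if i ≤ j then B' j else 0) := by
  induction ℓ generalizing t I B r with
  | zero => exact ⟨t, I, B, h, fun j hj => absurd hj (Nat.not_lt_zero j), rfl, fun i => le_rfl⟩
  | succ ℓ ih =>
    have h0 : r 0 ≤ I 0 := by simpa using hcum 1 (by omega)
    rcases Nat.eq_zero_or_pos ℓ with rfl | hℓ
    · refine ⟨t, I, B, h, fun j hj => ?_, rfl, fun i => le_rfl⟩
      obtain rfl : j = 0 := by omega
      exact h0
    -- Phase `0` keeps the fraction `θ` of its time that it needs and hands on the rest.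
    obtain ⟨θ, hθ0, hθ1, hθ⟩ : ∃ θ : ℝ, 0 ≤ θ ∧ θ ≤ 1 ∧ θ * I 0 = r 0 := by
      rcases eq_or_lt_of_le ((hr 0).trans h0) with hz | hz
      · exact ⟨1, zero_le_one, le_rfl, by have := hr 0; linarith⟩
      · exact ⟨r 0 / I 0, div_nonneg (hr 0) hz.le, (div_le_one hz).2 h0,
          div_mul_cancel₀ _ hz.ne'⟩
    set next : (ℕ → ℝ) → ℕ → ℝ := fun f j => f (j + 1) + if j = 0 then (1 - θ) * f 0 else 0
      with hnext
    have hsum : ∀ (f : ℕ → ℝ) (i : ℕ), 0 < i → ∑ j ∈ Finset.range i, next f j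
        = ∑ j ∈ Finset.range i, f (j + 1) + (1 - θ) * f 0 := by
      intro f i hi
      simp only [hnext, Finset.sum_add_distrib, Finset.sum_ite_eq', Finset.mem_range, hi, if_true]
    obtain ⟨t', I', B', hA, hI', ht', hB'⟩ := ih (next t) (next I) (next B) (fun j => r (j + 1))
      (fun j => by
        by_cases hj : j = 0
        · simp only [hnext, hj, if_true]
          exact (h _).add ((h 0).smul (sub_nonneg.2 hθ1))
        · simpa [hnext, hj] using h (j + 1))
      (fun j => by
        have h1 := mul_nonneg (sub_nonneg.2 hθ1) (hB 0)
        simp only [hnext]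
        split_ifs
        exacts [add_nonneg (hB _) h1, by simpa using hB (j + 1)])
      (fun j => hr _)
      (fun i hi => by
        rcases Nat.eq_zero_or_pos i with rfl | hi0
        · simp
        · have := hcum (i + 1) (by omega)
          rw [Finset.sum_range_succ', Finset.sum_range_succ'] at this
          rw [hsum I i hi0]
          linarith)
    refine ⟨fun j => Nat.casesOn j (θ * t 0) t', fun j => Nat.casesOn j (θ * I 0) I',
      fun j => Nat.casesOn j (θ * B 0) B', ?_, ?_, ?_, ?_⟩
    · rintro (_ | j)
      exacts [(h 0).smul hθ0, hA j]
    · rintro (_ | j) hj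
      exacts [hθ.ge, hI' j (by omega)]
    · rw [Finset.sum_range_succ', Finset.sum_range_succ']
      have := hsum t ℓ hℓ
      change ∑ j ∈ Finset.range ℓ, t' j + θ * t 0 = _
      rw [ht', this]
      ring
    · rintro (_ | i)
      · have h1 := hB' 0
        simp only [Nat.zero_le, if_true] at h1 ⊢
        rw [hsum B ℓ hℓ] at h1
        rw [Finset.sum_range_succ', Finset.sum_range_succ']
        change _ ≤ ∑ j ∈ Finset.range ℓ, B' j + θ * B 0
        linarith
      · have h1 := hB' i
        rw [Finset.sum_range_succ', Finset.sum_range_succ']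
        simp only [Nat.add_le_add_iff_right, Nat.le_zero, Nat.add_one_ne_zero, if_false, add_zero]
        refine le_trans (Finset.sum_le_sum fun j _ => ?_) h1
        have h2 := mul_nonneg (sub_nonneg.2 hθ1) (hB 0)
        simp only [hnext]
        split_ifs <;> linarith

end TimeSharing

/-! ### Phases of the transmission -/

section Phases

open scoped Classical

variable {X Y : Type*} [Fintype X] [Fintype Y] {ch : Channel X Y}

lemma Achievable.sum [Nonempty X] {ι : Type*} (s : Finset ι) {t I B : ι → ℝ}
    (h : ∀ i, Achievable ch (t i) (I i) (B i)) :
    Achievable ch (∑ i ∈ s, t i) (∑ i ∈ s, I i) (∑ i ∈ s, B i) := by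
  induction s using Finset.induction_on with
  | empty => simpa using achievable_zero
  | insert a s ha ih => simpa only [Finset.sum_insert ha] using (h a).add ih

lemma achievable_stoppedExp [Nonempty X] {k : List Y → Y → ℝ} (hk : IsKernel k)
    {σ : List Y → Prop} {t I B : List Y → ℝ}
    (h : ∀ s, Achievable ch (t s) (I s) (B s)) (n : ℕ) :
    Achievable ch (stoppedExp k σ n t) (stoppedExp k σ n I) (stoppedExp k σ n B) := by
  induction n generalizing t I B with
  | zero => exact h []
  | succ n ih =>
    refine ih fun s => ?_
    by_cases hs : σ s
    · simpa only [stoppedStep, hs, if_true] using h s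
    · simp only [stoppedStep, hs, if_false]
      exact Achievable.sum _ fun y => (h (y :: s)).smul (hk.pos s y).le

/-- The sum of `f` over the steps before time `N` at nodes that satisfy `p`, in expectation. -/
def expSum (k : List Y → Y → ℝ) (τ : List Y → Prop) (N : ℕ) (p : List Y → Prop)
    (f : List Y → ℝ) : ℝ :=
  ∑ n ∈ Finset.range N, stoppedExp k τ n (fun s => if p s then f s else 0)

variable {k : List Y → Y → ℝ} {τ : List Y → Prop} {N : ℕ} {f f' : List Y → ℝ}

lemma expSum_mono (hk : IsKernel k) {p : List Y → Prop} (h : ∀ s, f s ≤ f' s) :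
    expSum k τ N p f ≤ expSum k τ N p f' :=
  Finset.sum_le_sum fun n _ => stoppedExp_mono hk (fun s => by
    split_ifs
    exacts [h s, le_rfl]) n

lemma expSum_union {p q r : List Y → Prop} (h : ∀ s, r s ↔ p s ∨ q s)
    (hd : ∀ s, p s → ¬ q s) :
    expSum k τ N r f = expSum k τ N p f + expSum k τ N q f := by
  simp only [expSum, ← Finset.sum_add_distrib, ← stoppedExp_add]
  refine Finset.sum_congr rfl fun n _ => ?_
  congr 1
  funext s
  by_cases hp : p s
  · simp [(h s).2 (Or.inl hp), hp, hd s hp]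
  · by_cases hq : q s
    · simp [(h s).2 (Or.inr hq), hp, hq]
    · simp [mt (h s).1 (by tauto), hp, hq]

lemma expSum_eq_zero (hk : IsKernel k) {p : List Y → Prop} (h : ∀ s, ¬ p s) :
    expSum k τ N p f = 0 := by
  refine Finset.sum_eq_zero fun n _ => ?_
  simpa only [h, if_false] using stoppedExp_const hk 0 n

variable {σ : ℕ → List Y → Prop}

lemma expSum_before (hk : IsKernel k) (h0 : ∀ s, σ 0 s) (hσ : ∀ i s, σ (i + 1) s → σ i s)
    (i : ℕ) : expSum k τ N (fun s => ¬ σ i s) f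
      = ∑ j ∈ Finset.range i, expSum k τ N (fun s => σ j s ∧ ¬ σ (j + 1) s) f := by
  induction i with
  | zero => simpa using expSum_eq_zero hk fun s => not_not_intro (h0 s)
  | succ i ih =>
    rw [Finset.sum_range_succ, ← ih]
    refine expSum_union (fun s => ?_) (fun s h1 h2 => h1 h2.1)
    have := hσ i s
    tauto

lemma expSum_after (hσ : ∀ i s, σ (i + 1) s → σ i s) (hτ : ∀ i s, τ s → σ i s) (i : ℕ) {ℓ : ℕ}
    (hi : i ≤ ℓ) : expSum k τ N (fun s => σ i s ∧ ¬ τ s) f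
      = ∑ j ∈ Finset.range ℓ,
          (if i ≤ j then expSum k τ N (fun s => σ j s ∧ ¬ σ (j + 1) s) f else 0)
        + expSum k τ N (fun s => σ ℓ s ∧ ¬ τ s) f := by
  induction ℓ, hi using Nat.le_induction with
  | base =>
    rw [Finset.sum_eq_zero, zero_add]
    intro j hj
    rw [if_neg (by simpa using hj)]
  | succ ℓ hi ih =>
    rw [ih, Finset.sum_range_succ, if_pos hi, add_assoc]
    congr 1
    refine expSum_union (fun s => ?_) (fun s h1 h2 => h1.2 h2.1)
    have h1 := hσ ℓ s
    have h2 := hτ (ℓ + 1) s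
    tauto

variable {𝓜 : Type*} [Fintype 𝓜] [Nonempty 𝓜] {β : ℕ → Type*}

/-- The bounds for a finite horizon `N`. The labels `g 0, g 1, …` become finer and finer, the label
`g i` takes `K i` equally likely values, and the phase `j` extends from the moment when `g j` is
known reliably to the moment when `g (j + 1)` is. -/
lemma exists_phases (enc : 𝓜 → List Y → X) (dec : List Y → 𝓜) (g : ∀ i, 𝓜 → β i)
    {δ p Pe ε T : ℝ} (hδ : 0 < δ) (hδ1 : δ ≤ 1)
    (hg0 : ∀ m m', g 0 m = g 0 m') (hg : ∀ i m m', g (i + 1) m = g (i + 1) m' → g i m = g i m')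
    (K : ℕ → ℝ) (hK1 : ∀ i, 1 ≤ K i)
    (hK : ∀ i m, ((Finset.univ.filter fun m' => g i m' = g i m).card : ℝ) * K i
      = Fintype.card 𝓜)
    (hKδ : ∀ i, 0 < i → 1 < (1 - δ) * K i) (hroot : ¬ τ [])
    (hPe : stoppedExp (predictive ch enc) τ N
      (fun s => if τ s then postProb ch enc s (fun m => m ≠ dec s) else 0) ≤ Pe)
    (hPe0 : 0 ≤ Pe)
    (hp : stoppedExp (predictive ch enc) τ N (fun s => if τ s then 0 else 1) ≤ p)
    (e : ℕ → ℝ) (he0 : ∀ i, 0 < e i)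
    (he : ∀ i, stoppedExp (predictive ch enc) τ N
      (fun s => if τ s then postProb ch enc s (fun m => g i m ≠ g i (dec s)) else 0) ≤ e i)
    (hT : expSum (predictive ch enc) τ N (fun s => ¬ τ s) (fun _ => 1) ≤ T)
    (hε0 : 0 < ε) (hε : ε ≤ 1 / 2) (hsum : p + Pe + δ + Pe / δ ≤ ε) (ℓ : ℕ) :
    ∃ t I B : ℕ → ℝ, (∀ j, Achievable ch (t j) (I j) (B j)) ∧ (∀ j, t j ≤ T) ∧
      ∑ j ∈ Finset.range ℓ, t j ≤ T ∧
      (∀ i, 0 < i → (1 - ε) * Real.log (K i) - Real.binEntropy ε ≤ ∑ j ∈ Finset.range i, I j) ∧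
      (∀ i, 0 < i → i ≤ ℓ →
        (1 - ε) * -Real.log (e i) - (Real.binEntropy ε - Real.log (ch.minProb * δ)) ≤
          (T - ∑ j ∈ Finset.range ℓ, t j) * ch.maxDiv +
            ∑ j ∈ Finset.range ℓ, (if i ≤ j then B j else 0)) := by
  have : Nonempty X := ⟨enc (Classical.arbitrary 𝓜) []⟩
  have hk := isKernel_predictive ch enc
  set k := predictive ch enc with hkdef
  set σ : ℕ → List Y → Prop := fun i => LabelStop ch enc τ (g i) δ with hσ
  have hδ1' : δ < 1 := by
    by_contra! hcon
    nlinarith [hKδ 1 one_pos, hK1 1]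
  have hσ0 : ∀ s, σ 0 s := by
    have hc : ∀ s, Concentrated ch enc (g 0) δ s := fun s => by
      refine ⟨Classical.arbitrary 𝓜, ?_⟩
      simp only [hg0 _ (Classical.arbitrary 𝓜), postProb, if_true, mul_one, sum_posterior]
      linarith
    rintro (_ | ⟨y, s⟩)
    exacts [Or.inr (hc _), Or.inr (Or.inr (hc _))]
  have hσs : ∀ i s, σ (i + 1) s → σ i s := fun i s h => LabelStop.of_finer (hg i) h
  have hστ : ∀ i s, τ s → σ i s := fun i s h => labelStop_of_stop s h
  have hσroot : ∀ i, 0 < i → ¬ σ i [] := by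
    rintro i hi (h | ⟨m, hm⟩)
    · exact hroot h
    · have hcard : (0 : ℝ) < Fintype.card 𝓜 := by exact_mod_cast Fintype.card_pos
      have h1 : postProb ch enc [] (fun m' => g i m' = g i m)
          = ((Finset.univ.filter fun m' => g i m' = g i m).card : ℝ) / Fintype.card 𝓜 := by
        simp only [postProb, posterior, ← Finset.mul_sum, Finset.sum_boole]
        ring
      rw [h1, le_div_iff₀ hcard, ← hK i m] at hm
      have h2 := hKδ i hi
      have h3 : (0 : ℝ) < ((Finset.univ.filter fun m' => g i m' = g i m).card : ℝ) := by
        have : m ∈ Finset.univ.filter fun m' => g i m' = g i m := by simp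
        exact_mod_cast Finset.card_pos.2 ⟨m, this⟩
      nlinarith
  set phase : ℕ → List Y → Prop := fun j s => σ j s ∧ ¬ σ (j + 1) s with hphase
  set info : List Y → ℝ := fun s => ch.mutualInfo (inputDist ch enc s) with hinfo
  set div : List Y → ℝ := fun s => ch.maxDivFrom (inputDist ch enc s) with hdiv
  have hone : ∀ (q : List Y → Prop), 0 ≤ expSum k τ N q (fun _ => 1) := fun q =>
    Finset.sum_nonneg fun n _ => stoppedExp_nonneg hk (fun s => by split_ifs <;> simp) n
  have htime : expSum k τ N (fun s => ¬ τ s) (fun _ => 1)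
      = ∑ j ∈ Finset.range ℓ, expSum k τ N (phase j) (fun _ => 1)
        + expSum k τ N (fun s => σ ℓ s ∧ ¬ τ s) (fun _ => 1) := by
    rw [← expSum_before hk hσ0 hσs ℓ]
    refine expSum_union (fun s => ?_) (fun s h1 h2 => h1 h2.1)
    have := hστ ℓ s
    tauto
  refine ⟨fun j => expSum k τ N (phase j) (fun _ => 1), fun j => expSum k τ N (phase j) info,
    fun j => expSum k τ N (phase j) div, fun j => ?_, fun j => ?_, ?_, fun i hi => ?_,
    fun i hi hiℓ => ?_⟩
  · refine Achievable.sum _ fun n => achievable_stoppedExp hk (fun s => ?_) n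
    split_ifs
    exacts [achievable_one (inputDist_mem ch enc s), achievable_zero]
  · refine le_trans ?_ hT
    refine Finset.sum_le_sum fun n _ => stoppedExp_mono hk (fun s => ?_) n
    by_cases h : phase j s
    · rw [if_pos h, if_pos fun h' => h.2 (hστ _ _ h')]
    · rw [if_neg h]
      split_ifs <;> simp
  · linarith [hone (fun s => σ ℓ s ∧ ¬ τ s)]
  · rw [← expSum_before hk hσ0 hσs i]
    refine (log_card_le_sum_mutualInfo hδ hPe hp hε0 hε (by linarith) (hK1 i) (hK i)).trans
      (le_of_eq ?_)
    refine Finset.sum_congr rfl fun n _ => ?_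
    congr 1
    funext s
    by_cases h : LabelStop ch enc τ (g i) δ s
    · rw [if_pos h, if_neg (not_not_intro h)]
    · rw [if_neg h, if_pos h]
  · have h1 := neg_log_errProb_le_sum_maxDivFrom hδ hδ1 (hσroot i hi) hPe hp (he0 i) (he i)
      hε0 hε hsum
    have h2 : expSum k τ N (fun s => σ i s ∧ ¬ τ s) div = _ := expSum_after hσs hστ i hiℓ
    have h3 : expSum k τ N (fun s => σ ℓ s ∧ ¬ τ s) div
        ≤ expSum k τ N (fun s => σ ℓ s ∧ ¬ τ s) (fun _ => ch.maxDiv * 1) :=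
      expSum_mono hk fun s => by
        rw [mul_one]
        exact ch.maxDivFrom_le_maxDiv (inputDist_mem ch enc s)
    have h4 : expSum k τ N (fun s => σ ℓ s ∧ ¬ τ s) (fun _ => ch.maxDiv * 1)
        = ch.maxDiv * expSum k τ N (fun s => σ ℓ s ∧ ¬ τ s) (fun _ => 1) := by
      simp only [expSum, Finset.mul_sum, ← stoppedExp_const_mul, mul_ite, mul_zero]
    have h5 : ch.maxDiv * expSum k τ N (fun s => σ ℓ s ∧ ¬ τ s) (fun _ => 1)
        ≤ ch.maxDiv * (T - ∑ j ∈ Finset.range ℓ, expSum k τ N (phase j) (fun _ => 1)) :=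
      mul_le_mul_of_nonneg_left (by linarith) ch.maxDiv_nonneg
    have h6 : expSum k τ N (fun s => σ i s ∧ ¬ τ s) div = ∑ n ∈ Finset.range N,
        stoppedExp k τ n (fun s => if LabelStop ch enc τ (g i) δ s ∧ ¬ τ s then
          ch.maxDivFrom (inputDist ch enc s) else 0) := by
      refine Finset.sum_congr rfl fun n _ => ?_
      congr 1
      funext s
      congr
    rw [← h6, h2] at h1
    refine h1.trans ?_
    rw [mul_comm (T - _)]
    linarith

end Phases

/-! ### The transmission as a chain on the tree of output sequences -/

section Bridge

open scoped Classical

variable {𝓜 X Y : Type*}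

/-- The list of the first `n` letters of an output sequence, the latest one first. -/
def outputList {n : ℕ} (v : Fin n → Y) : List Y := (List.ofFn v).reverse

lemma outputList_snoc {n : ℕ} (v : Fin n → Y) (y : Y) :
    outputList (Fin.snoc (α := fun _ => Y) v y) = y :: outputList v := by
  rw [outputList, List.ofFn_succ', List.concat_eq_append, List.reverse_append]
  simp [outputList]

lemma length_outputList {n : ℕ} (v : Fin n → Y) : (outputList v).length = n := by
  simp [outputList]

variable (c : Code 𝓜 X Y)

variable {c} in
lemma time_eq_of_agree {y z : ℕ → Y} {n : ℕ} (hn : c.time y ≤ n) (h : ∀ k < n, y k = z k) :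
    c.time z = c.time y := by
  obtain ⟨t, ht⟩ := ENat.ne_top_iff_exists.1 (ne_top_of_le_ne_top (ENat.natCast_ne_top n) hn)
  rw [← ht] at hn ⊢
  have htn : t ≤ n := by exact_mod_cast hn
  exact c.time_markov t y z (fun k hk => h k (by omega)) ht.symm

variable {c} in
lemma decode_eq_of_agree {y z : ℕ → Y} {n : ℕ} (hn : c.time y ≤ n) (h : ∀ k < n, y k = z k) :
    c.decode y = c.decode z := by
  refine c.decode_time y z fun k hk => h k ?_
  have := hk.trans_le hn
  exact_mod_cast this

variable [Nonempty Y]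

/-- An output sequence that starts with the outputs in `s`, of which the first element is the latest
one. -/
def extend (s : List Y) (k : ℕ) : Y := s.reverse.getD k (Classical.arbitrary Y)

lemma extend_cons_of_lt {s : List Y} {k : ℕ} (hk : k < s.length) (y : Y) :
    extend (y :: s) k = extend s k := by
  unfold extend
  rw [List.reverse_cons, List.getD_append _ _ _ _ (by simpa using hk)]

lemma extend_cons_length (s : List Y) (y : Y) : extend (y :: s) s.length = y := by
  unfold extend
  rw [List.reverse_cons, List.getD_append_right _ _ _ _ (by simp)]
  simp

lemma extend_outputList {n : ℕ} (v : Fin n → Y) (k : Fin n) : extend (outputList v) k = v k := by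
  simp [extend, outputList]

/-- The encoder as a function of the node. -/
def treeEncode (m : 𝓜) (s : List Y) : X := c.encode m s.length fun k => extend s k

/-- Decoding takes place at or before the node. -/
def TreeStop (s : List Y) : Prop := c.time (extend s) ≤ s.length

/-- The message that is decoded; meaningful at the nodes satisfying `TreeStop`. -/
def treeDecode (s : List Y) : 𝓜 := c.decode (extend s)

variable {c}

lemma not_treeStop_nil : ¬ TreeStop c [] := by
  intro h
  have := (c.one_le_time (extend [])).trans h
  simp at this

lemma TreeStop.cons (s : List Y) (y : Y) (h : TreeStop c s) : TreeStop c (y :: s) := by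
  unfold TreeStop
  rw [time_eq_of_agree h fun k hk => (extend_cons_of_lt hk y).symm]
  exact h.trans (by simp)

lemma treeDecode_cons {s : List Y} (h : TreeStop c s) (y : Y) :
    treeDecode c (y :: s) = treeDecode c s :=
  (decode_eq_of_agree h fun _ hk => (extend_cons_of_lt hk y).symm).symm

lemma treeStop_outputList (z : ℕ → Y) (n : ℕ) :
    TreeStop c (outputList fun k : Fin n => z k) ↔ c.time z ≤ n := by
  have h : ∀ k < n, extend (outputList fun k : Fin n => z k) k = z k := fun k hk =>
    extend_outputList (fun k : Fin n => z k) ⟨k, hk⟩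
  unfold TreeStop
  rw [length_outputList]
  constructor
  · intro hs
    rwa [time_eq_of_agree hs h]
  · intro hs
    rwa [time_eq_of_agree hs fun k hk => (h k hk).symm]

lemma treeDecode_outputList {z : ℕ → Y} {n : ℕ} (hz : c.time z ≤ n) :
    treeDecode c (outputList fun k : Fin n => z k) = c.decode z := by
  have h : ∀ k < n, extend (outputList fun k : Fin n => z k) k = z k := fun k hk =>
    extend_outputList (fun k : Fin n => z k) ⟨k, hk⟩
  exact (decode_eq_of_agree hz fun k hk => (h k hk).symm).symm

variable [Fintype Y] [Fintype 𝓜] {ch : Channel X Y} {Ω : Type*} [MeasurableSpace Ω]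
  {P : Measure Ω} {msg : Ω → 𝓜} {out : ℕ → Ω → Y}

lemma sum_indicator_lt_le (N : ℕ) (t : ℕ∞) :
    ∑ n ∈ Finset.range N, (if (n : ℕ∞) < t then (1 : ℝ≥0∞) else 0) ≤ (t : ℝ≥0∞) := by
  induction t using ENat.recTopCoe with
  | top => simp
  | coe t =>
    rw [← Finset.sum_filter, Finset.sum_const, nsmul_eq_mul, mul_one]
    have : ((Finset.range N).filter fun n : ℕ => (n : ℕ∞) < t).card ≤ t := by
      calc _ ≤ (Finset.range t).card := by
            refine Finset.card_le_card fun n hn => ?_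
            simpa using (Finset.mem_filter.1 hn).2
        _ = t := Finset.card_range t
    exact_mod_cast this

/-- The event that the message is `m` and the first outputs are those in `s`. -/
def nodeEvent (msg : Ω → 𝓜) (out : ℕ → Ω → Y) (m : 𝓜) (s : List Y) : Set Ω :=
  {ω | msg ω = m ∧ ∀ k < s.length, out k ω = extend s k}

lemma measureReal_nodeEvent_nil (htr : IsTransmission ch c P msg out) (m : 𝓜) :
    P.real (nodeEvent msg out m []) = 1 / (Fintype.card 𝓜 : ℝ) := by
  simpa [nodeEvent] using htr.uniform m

lemma measureReal_nodeEvent_cons (htr : IsTransmission ch c P msg out) (m : 𝓜) (s : List Y)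
    (y : Y) : P.real (nodeEvent msg out m (y :: s))
      = P.real (nodeEvent msg out m s) * messageKernel ch (treeEncode c) m s y := by
  have h := htr.memoryless m s.length (extend (y :: s))
  have h1 : {ω | msg ω = m ∧ ∀ k < s.length, out k ω = extend (y :: s) k}
      = nodeEvent msg out m s := by
    ext ω
    refine and_congr_right fun _ => forall₂_congr fun k hk => ?_
    rw [extend_cons_of_lt hk]
  have h2 : (fun k : Fin s.length => extend (y :: s) k) = fun k : Fin s.length => extend s k :=
    funext fun k => extend_cons_of_lt k.2 y
  rw [h1, h2, extend_cons_length] at h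
  exact h

lemma measureReal_nodeEvent_pos [Nonempty 𝓜] (htr : IsTransmission ch c P msg out) (m : 𝓜)
    (s : List Y) : 0 < P.real (nodeEvent msg out m s) := by
  induction s with
  | nil =>
    rw [measureReal_nodeEvent_nil htr]
    have : (0 : ℝ) < Fintype.card 𝓜 := by exact_mod_cast Fintype.card_pos
    positivity
  | cons y s ih =>
    rw [measureReal_nodeEvent_cons htr]
    exact mul_pos ih (ch.pos _ _)

lemma sum_measureReal_nodeEvent_mul (htr : IsTransmission ch c P msg out) (m : 𝓜) (n : ℕ)
    (f : List Y → ℝ) :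
    ∑ v : Fin n → Y, P.real (nodeEvent msg out m (outputList v)) * f (outputList v)
      = 1 / (Fintype.card 𝓜 : ℝ) *
        stoppedExp (messageKernel ch (treeEncode c) m) (fun _ => False) n f := by
  induction n generalizing f with
  | zero =>
    simp [outputList, stoppedExp, measureReal_nodeEvent_nil htr]
  | succ n ih =>
    rw [← (Fin.snocEquiv fun _ : Fin (n + 1) => Y).sum_comp, Fintype.sum_prod_type_right,
      stoppedExp, ← ih]
    refine Finset.sum_congr rfl fun v _ => ?_
    simp only [stoppedStep, if_false, Finset.mul_sum]
    refine Finset.sum_congr rfl fun y _ => ?_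
    change P.real (nodeEvent msg out m (outputList (Fin.snoc (α := fun _ => Y) v y))) *
      f (outputList (Fin.snoc (α := fun _ => Y) v y)) = _
    rw [outputList_snoc, measureReal_nodeEvent_cons htr, mul_assoc]

omit [Fintype Y] [MeasurableSpace Ω] [Fintype 𝓜] in
lemma nodeEvent_outputList (m : 𝓜) {n : ℕ} (v : Fin n → Y) :
    nodeEvent msg out m (outputList v) = {ω | msg ω = m ∧ (fun k : Fin n => out k ω) = v} := by
  ext ω
  refine and_congr_right fun _ => ?_
  rw [length_outputList, funext_iff]
  constructor
  · intro h k
    rw [h k k.2, extend_outputList]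
  · intro h k hk
    rw [← h ⟨k, hk⟩ |>.trans (extend_outputList v ⟨k, hk⟩).symm]

lemma measurableSet_nodeEvent (htr : IsTransmission ch c P msg out) (m : 𝓜) (s : List Y) :
    MeasurableSet (nodeEvent msg out m s) := by
  have : nodeEvent msg out m s
      = {ω | msg ω = m} ∩ ⋂ k ∈ Finset.range s.length, {ω | out k ω = extend s k} := by
    ext ω
    simp [nodeEvent]
  rw [this]
  exact (htr.measurable_msg m).inter
    (Finset.measurableSet_biInter _ fun k _ => htr.measurable_out k _)

omit [MeasurableSpace Ω] in
lemma setOf_outputList_eq (n : ℕ) (Q : 𝓜 → List Y → Prop) :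
    {ω | Q (msg ω) (outputList fun k : Fin n => out k ω)}
      = ⋃ q ∈ (Finset.univ : Finset (𝓜 × (Fin n → Y))).filter fun q => Q q.1 (outputList q.2),
        nodeEvent msg out q.1 (outputList q.2) := by
  ext ω
  simp only [nodeEvent_outputList, Set.mem_ofPred_eq, Set.mem_iUnion, Finset.mem_filter,
    Finset.mem_univ, true_and, exists_prop, Prod.exists]
  constructor
  · intro h
    exact ⟨_, _, h, rfl, rfl⟩
  · rintro ⟨m, v, h, rfl, rfl⟩
    exact h

lemma measurableSet_outputList (htr : IsTransmission ch c P msg out) (n : ℕ)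
    (Q : 𝓜 → List Y → Prop) :
    MeasurableSet {ω | Q (msg ω) (outputList fun k : Fin n => out k ω)} := by
  rw [setOf_outputList_eq]
  exact Finset.measurableSet_biUnion _ fun q _ => measurableSet_nodeEvent htr _ _

variable [IsProbabilityMeasure P]

/-- The chain on the tree describes the distribution of the message and the outputs. -/
lemma measureReal_outputList [Nonempty 𝓜] (htr : IsTransmission ch c P msg out) (n : ℕ)
    (Q : 𝓜 → List Y → Prop) :
    P.real {ω | Q (msg ω) (outputList fun k : Fin n => out k ω)}
      = stoppedExp (predictive ch (treeEncode c)) (fun _ => False) n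
          (fun s => postProb ch (treeEncode c) s fun m => Q m s) := by
  rw [setOf_outputList_eq, measureReal_biUnion_finset]
  · unfold postProb
    rw [← average_stoppedExp_messageKernel ch (treeEncode c) _ (fun m s => if Q m s then 1 else 0),
      Finset.sum_filter, Fintype.sum_prod_type]
    refine Finset.sum_congr rfl fun m _ => ?_
    rw [← sum_measureReal_nodeEvent_mul htr]
    refine Finset.sum_congr rfl fun v _ => ?_
    simp
  · intro q _ q' _ hne
    rw [Function.onFun, Set.disjoint_left]
    intro ω h h'
    rw [nodeEvent_outputList] at h h'
    exact hne (Prod.ext (h.1.symm.trans h'.1) (h.2.symm.trans h'.2))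
  · exact fun q _ => measurableSet_nodeEvent htr _ _

omit [Fintype Y] [Fintype 𝓜] [MeasurableSpace Ω] in
lemma setOf_lt_time (n : ℕ) : {ω | (n : ℕ∞) < c.time fun k => out k ω}
    = {ω | ¬ TreeStop c (outputList fun k : Fin n => out k ω)} := by
  ext ω
  simp only [Set.mem_ofPred_eq, treeStop_outputList (fun k => out k ω), not_le]

/-- The expected number of uses of the channel before time `N`. -/
lemma sum_measureReal_time_le (htr : IsTransmission ch c P msg out)
    (hfin : c.expTime P out ≠ ⊤) (N : ℕ) :
    ∑ n ∈ Finset.range N, P.real {ω | (n : ℕ∞) < c.time fun k => out k ω}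
      ≤ (c.expTime P out).toReal := by
  have hmeas : ∀ n : ℕ, MeasurableSet {ω | (n : ℕ∞) < c.time fun k => out k ω} := by
    intro n
    rw [setOf_lt_time]
    exact measurableSet_outputList htr n fun _ s => ¬ TreeStop c s
  have hind : ∀ n : ℕ, (fun ω => if (n : ℕ∞) < c.time fun k => out k ω then (1 : ℝ≥0∞) else 0)
      = {ω | (n : ℕ∞) < c.time fun k => out k ω}.indicator 1 := by
    intro n
    funext ω
    simp [Set.indicator_apply]
  have h : ∑ n ∈ Finset.range N, P {ω | (n : ℕ∞) < c.time fun k => out k ω}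
      ≤ c.expTime P out := by
    unfold Code.expTime
    calc ∑ n ∈ Finset.range N, P {ω | (n : ℕ∞) < c.time fun k => out k ω}
        = ∑ n ∈ Finset.range N, ∫⁻ ω, (if (n : ℕ∞) < c.time fun k => out k ω then 1 else 0) ∂P := by
          refine Finset.sum_congr rfl fun n _ => ?_
          rw [← lintegral_indicator_one (hmeas n), hind]
      _ = ∫⁻ ω, ∑ n ∈ Finset.range N,
            (if (n : ℕ∞) < c.time fun k => out k ω then 1 else 0) ∂P := by
          rw [lintegral_finsetSum]
          intro n _
          rw [hind]
          exact measurable_one.indicator (hmeas n)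
      _ ≤ _ := lintegral_mono fun ω => sum_indicator_lt_le N _
  simp only [Measure.real]
  rw [← ENNReal.toReal_sum fun n _ => measure_ne_top P _]
  exact ENNReal.toReal_mono hfin h

/-- Markov's inequality for the decoding time. -/
lemma measureReal_time_le_div (htr : IsTransmission ch c P msg out)
    (hfin : c.expTime P out ≠ ⊤) {N : ℕ} (hN : 0 < N) :
    P.real {ω | (N : ℕ∞) < c.time fun k => out k ω} ≤ (c.expTime P out).toReal / N := by
  rw [le_div_iff₀ (by exact_mod_cast hN)]
  refine le_trans ?_ (sum_measureReal_time_le htr hfin N)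
  calc _ = ∑ n ∈ Finset.range N, P.real {ω | (N : ℕ∞) < c.time fun k => out k ω} := by
        simp [mul_comm]
    _ ≤ _ := Finset.sum_le_sum fun n hn => measureReal_mono fun ω hω => by
        rw [Set.mem_ofPred_eq] at hω ⊢
        refine lt_trans ?_ hω
        exact_mod_cast Finset.mem_range.1 hn

variable [Nonempty 𝓜]

/-- The probability that decoding has not taken place by time `n`. -/
lemma stoppedExp_not_treeStop (htr : IsTransmission ch c P msg out) (n : ℕ) :
    stoppedExp (predictive ch (treeEncode c)) (TreeStop c) n
      (fun s => if TreeStop c s then 0 else 1)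
      = P.real {ω | (n : ℕ∞) < c.time fun k => out k ω} := by
  rw [stoppedExp_eq_of_eq_zero (ρ := fun _ => False) TreeStop.cons (fun _ h => h.elim)
    (fun s hs => if_pos hs)]
  rw [setOf_lt_time, measureReal_outputList htr n fun _ s => ¬ TreeStop c s]
  congr 1
  funext s
  by_cases hs : TreeStop c s
  · simp [hs, postProb]
  · simp [hs, postProb, sum_posterior]

/-- Decoding errors of a given kind before time `n` are at most as probable as all such errors. -/
lemma stoppedExp_error_le (htr : IsTransmission ch c P msg out) (n : ℕ) (bad : 𝓜 → 𝓜 → Prop) :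
    stoppedExp (predictive ch (treeEncode c)) (TreeStop c) n
      (fun s => if TreeStop c s then
        postProb ch (treeEncode c) s (fun m => bad m (treeDecode c s)) else 0)
      ≤ P.real {ω | bad (msg ω) (c.decode fun k => out k ω)} := by
  rw [stoppedExp_eq_of_harmonic (ρ := fun _ => False) TreeStop.cons (fun _ h => h.elim)]
  · have h := measureReal_outputList htr n fun m s => TreeStop c s ∧ bad m (treeDecode c s)
    calc _ = _ := by
          congr 1
          funext s
          by_cases hs : TreeStop c s
          · simp only [hs, if_true, true_and]
          · simp [hs, postProb]
      _ = _ := h.symm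
      _ ≤ _ := by
          refine measureReal_mono ?_
          rintro ω ⟨h1, h2⟩
          rw [treeStop_outputList (fun k => out k ω)] at h1
          rwa [treeDecode_outputList (z := fun k => out k ω) h1] at h2
  · intro s hs
    simp only [stoppedStep, if_false, hs, if_true, TreeStop.cons s _ hs, treeDecode_cons hs]
    exact sum_predictive_mul_postProb ch (treeEncode c) s _

/-- As all transition probabilities are positive, each kind of error that occurs for every decoded
message has positive probability. -/
lemma measureReal_error_pos (htr : IsTransmission ch c P msg out) {bad : 𝓜 → 𝓜 → Prop}
    (hbad : ∀ a, ∃ m, bad m a) : 0 < P.real {ω | bad (msg ω) (c.decode fun k => out k ω)} := by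
  obtain ⟨ω, hω⟩ := htr.time_finite.exists
  obtain ⟨n, hn⟩ := ENat.ne_top_iff_exists.1 hω
  set s := outputList fun k : Fin n => out k ω with hs
  have hdone : TreeStop c s := (treeStop_outputList (fun k => out k ω) n).2 hn.symm.le
  obtain ⟨m, hm⟩ := hbad (treeDecode c s)
  refine (measureReal_nodeEvent_pos htr m s).trans_le (measureReal_mono ?_)
  rintro ω' ⟨rfl, h2⟩
  have : c.decode (fun k => out k ω') = treeDecode c s :=
    (decode_eq_of_agree hdone fun k hk => (h2 k hk).symm).symm
  rw [Set.mem_ofPred_eq, this]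
  exact hm

end Bridge

/-! ### Sub-messages and the limit of long horizons -/

section Final

open scoped Classical

open Filter Topology

lemma Achievable.div_nonpos {X Y : Type*} [Fintype X] [Fintype Y] {ch : Channel X Y} {I B : ℝ}
    (h : Achievable ch 0 I B) : B ≤ 0 := by
  obtain ⟨a, ha, b, hb, u, v, hu, hv, huv, -, hB⟩ := h
  obtain rfl : u = 0 := by linarith
  obtain rfl : v = 0 := by linarith
  simpa using hB

/-- The loss `h(ε)` in Fano's inequality is smaller than the information in one bit, so that the first
phase always has a non-negative demand. -/
lemma binEntropy_le_one_sub_mul_log {ε K : ℝ} (hε0 : 0 < ε) (hε : ε ≤ 1 / 5) (hK : 2 ≤ K) :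
    Real.binEntropy ε ≤ (1 - ε) * Real.log K := by
  have h1 : Real.binEntropy ε ≤ Real.binEntropy (1 / 5) :=
    Real.binEntropy_strictMonoOn.monotoneOn ⟨hε0.le, by norm_num; linarith⟩ (by norm_num) hε
  have h2 : Real.binEntropy (1 / 5) = Real.log 5 - 8 / 5 * Real.log 2 := by
    have h4 : Real.log (5 / 4) = Real.log 5 - 2 * Real.log 2 := by
      rw [Real.log_div (by norm_num) (by norm_num), show (4 : ℝ) = 2 ^ 2 by norm_num, Real.log_pow]
      norm_num
    rw [Real.binEntropy, show (1 / 5 : ℝ)⁻¹ = 5 by norm_num,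
      show (1 - 1 / 5 : ℝ)⁻¹ = 5 / 4 by norm_num, h4]
    ring
  -- The numerical comparison is `5 ^ 5 ≤ 2 ^ 12`.
  have h3 : 5 * Real.log 5 ≤ 12 * Real.log 2 := by
    have := Real.log_le_log (by norm_num) (show (5 : ℝ) ^ 5 ≤ 2 ^ 12 by norm_num)
    rw [Real.log_pow, Real.log_pow] at this
    exact_mod_cast this
  have h5 : Real.log 2 ≤ Real.log K := Real.log_le_log (by norm_num) hK
  have h6 : 0 < Real.log 2 := Real.log_pos (by norm_num)
  nlinarith

variable {X Y : Type*} [Fintype Y] {ch : Channel X Y} {ℓ : ℕ} {S : Fin ℓ → Type*}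

/-- The first `i` sub-messages. -/
def initial (i : ℕ) (m : ∀ j, S j) : ∀ j : {j : Fin ℓ // j.val < i}, S j := fun j => m j

lemma initial_eq_iff {i : ℕ} {m m' : ∀ j, S j} :
    initial i m = initial i m' ↔ ∀ j : Fin ℓ, j.val < i → m j = m' j := by
  simp [initial, funext_iff]

/-- The number of values of the first `i` sub-messages. -/
def initialCard (S : Fin ℓ → Type*) [∀ j, Fintype (S j)] (i : ℕ) : ℝ :=
  ∏ j : Fin ℓ, if j.val < i then (Fintype.card (S j) : ℝ) else 1

variable [∀ j, Fintype (S j)]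

lemma card_initial_mul (i : ℕ) (m : ∀ j, S j) :
    ((Finset.univ.filter fun m' => initial i m' = initial i m).card : ℝ) * initialCard S i
      = Fintype.card (∀ j, S j) := by
  have h : (Finset.univ.filter fun m' => initial i m' = initial i m)
      = Fintype.piFinset fun j : Fin ℓ => if j.val < i then {m j} else Finset.univ := by
    ext m'
    simp only [Finset.mem_filter, Finset.mem_univ, true_and, Fintype.mem_piFinset, initial_eq_iff]
    refine forall_congr' fun j => ?_
    split_ifs with hj <;> simp [hj]
  rw [h, Fintype.card_piFinset, Fintype.card_pi, initialCard, Nat.cast_prod, Nat.cast_prod,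
    ← Finset.prod_mul_distrib]
  refine Finset.prod_congr rfl fun j _ => ?_
  split_ifs <;> simp

/-- `ln |S_j|`, extended by `0` to all natural numbers `j`. -/
def logCard (S : Fin ℓ → Type*) [∀ j, Fintype (S j)] (j : ℕ) : ℝ :=
  if h : j < ℓ then Real.log (Fintype.card (S ⟨j, h⟩)) else 0

variable [∀ j, Nonempty (S j)]

omit [∀ j, Nonempty (S j)] in
lemma logCard_nonneg (j : ℕ) : 0 ≤ logCard S j := by
  unfold logCard
  split_ifs
  exacts [Real.log_natCast_nonneg _, le_rfl]

lemma one_le_initialCard (i : ℕ) : 1 ≤ initialCard S i := by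
  refine Finset.one_le_prod fun j _ => ?_
  split_ifs
  · exact_mod_cast Fintype.card_pos
  · exact le_rfl

lemma log_initialCard {i : ℕ} (hi : i ≤ ℓ) :
    Real.log (initialCard S i) = ∑ j ∈ Finset.range i, logCard S j := by
  have h1 : ∑ j ∈ Finset.range i, logCard S j
      = ∑ j ∈ Finset.range ℓ, if j < i then logCard S j else 0 := by
    rw [← Finset.sum_filter]
    congr 1
    ext j
    simp only [Finset.mem_filter, Finset.mem_range]
    omega
  rw [h1, Finset.sum_range, initialCard, Real.log_prod]
  · refine Finset.sum_congr rfl fun j _ => ?_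
    split_ifs <;> simp [logCard]
  · intro j _
    split_ifs
    · exact_mod_cast Fintype.card_ne_zero
    · exact one_ne_zero

lemma two_le_initialCard (hℓ : 0 < ℓ) (hS : 2 ≤ Fintype.card (S ⟨0, hℓ⟩)) {i : ℕ} (hi : 0 < i) :
    2 ≤ initialCard S i := by
  rw [initialCard, ← Finset.mul_prod_erase _ _ (Finset.mem_univ (⟨0, hℓ⟩ : Fin ℓ))]
  have h1 : (1 : ℝ) ≤ ∏ j ∈ Finset.univ.erase (⟨0, hℓ⟩ : Fin ℓ),
      if j.val < i then (Fintype.card (S j) : ℝ) else 1 := by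
    refine Finset.one_le_prod fun j _ => ?_
    split_ifs
    · exact_mod_cast Fintype.card_pos
    · exact le_rfl
  have h2 : (2 : ℝ) ≤ Fintype.card (S ⟨0, hℓ⟩) := by exact_mod_cast hS
  simp only [hi, if_true]
  nlinarith

variable {c : Code (∀ j, S j) X Y} {Ω : Type*} [MeasurableSpace Ω] {P : Measure Ω}
  [IsProbabilityMeasure P] {msg : Ω → ∀ j, S j} {out : ℕ → Ω → Y}

lemma subErrProb_pos (htr : IsTransmission ch c P msg out) (hℓ : 0 < ℓ)
    (hS : 2 ≤ Fintype.card (S ⟨0, hℓ⟩)) (i : Fin ℓ) : 0 < c.subErrProb P msg out i := by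
  have : Nonempty X := ⟨c.encode (Classical.arbitrary _) 0 (fun k => k.elim0)⟩
  have := ch.nonempty_output
  refine measureReal_error_pos htr (bad := fun m a => ∃ j ≤ i, a j ≠ m j) fun a => ?_
  have : Nontrivial (S ⟨0, hℓ⟩) := Fintype.one_lt_card_iff_nontrivial.1 hS
  obtain ⟨b, hb⟩ := exists_ne (a ⟨0, hℓ⟩)
  refine ⟨Function.update a ⟨0, hℓ⟩ b, ⟨0, hℓ⟩, Nat.zero_le i.val, ?_⟩
  simpa using hb.symm

variable [Fintype X]

/-- The bounds for the horizon `N`: decoding takes place before time `N` except with probability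
`E[τ] / N`. -/
lemma exists_phases_of_horizon (htr : IsTransmission ch c P msg out) (hℓ : 0 < ℓ)
    (hS : 2 ≤ Fintype.card (S ⟨0, hℓ⟩)) (hfin : c.expTime P out ≠ ⊤) {δ ε T : ℝ} (hδ : 0 < δ)
    (hT : T = (c.expTime P out).toReal) {N : ℕ} (hN : 0 < N)
    (hε : c.errProb P msg out + δ + c.errProb P msg out / δ + T / N = ε) (hε2 : ε ≤ 1 / 2)
    (hδ2 : δ < 1 / 2) :
    ∃ t I B : ℕ → ℝ, (∀ j, Achievable ch (t j) (I j) (B j)) ∧ (∀ j, t j ≤ T) ∧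
      ∑ j ∈ Finset.range ℓ, t j ≤ T ∧
      (∀ i, 0 < i → (1 - ε) * Real.log (initialCard S i) - Real.binEntropy ε
        ≤ ∑ j ∈ Finset.range i, I j) ∧
      (∀ i : Fin ℓ, (1 - ε) * -Real.log (c.subErrProb P msg out i)
          - (Real.binEntropy ε - Real.log (ch.minProb * δ)) ≤
        (T - ∑ j ∈ Finset.range ℓ, t j) * ch.maxDiv +
          ∑ j ∈ Finset.range ℓ, (if i.val + 1 ≤ j then B j else 0)) := by
  have : Nonempty X := ⟨c.encode (Classical.arbitrary _) 0 (fun k => k.elim0)⟩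
  have := ch.nonempty_output
  have hT0 : 0 ≤ T := hT ▸ ENNReal.toReal_nonneg
  have hPe0 : 0 ≤ c.errProb P msg out := measureReal_nonneg
  have hPeδ : 0 ≤ c.errProb P msg out / δ := div_nonneg hPe0 hδ.le
  have hTN : 0 ≤ T / N := by positivity
  -- The clamping serves the indices `0` and `i > ℓ`, at which no sub-message ends.
  set e : ℕ → ℝ := fun i => c.subErrProb P msg out ⟨min (i - 1) (ℓ - 1), by omega⟩ with he
  have hPe : stoppedExp (predictive ch (treeEncode c)) (TreeStop c) N (fun s =>
      if TreeStop c s then postProb ch (treeEncode c) s (fun m => m ≠ treeDecode c s) else 0)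
      ≤ c.errProb P msg out := by
    refine (stoppedExp_error_le htr N fun m a => m ≠ a).trans (measureReal_mono fun ω hω => ?_)
    exact Ne.symm hω
  have hp : stoppedExp (predictive ch (treeEncode c)) (TreeStop c) N
      (fun s => if TreeStop c s then 0 else 1) ≤ T / N := by
    rw [stoppedExp_not_treeStop htr, hT]
    exact measureReal_time_le_div htr hfin hN
  have hei : ∀ i, stoppedExp (predictive ch (treeEncode c)) (TreeStop c) N (fun s =>
      if TreeStop c s then postProb ch (treeEncode c) s
        (fun m => initial i m ≠ initial i (treeDecode c s)) else 0) ≤ e i := by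
    intro i
    refine (stoppedExp_error_le htr N fun m a => initial i m ≠ initial i a).trans
      (measureReal_mono fun ω hω => ?_)
    rw [Set.mem_ofPred_eq, ne_eq, initial_eq_iff, not_forall] at hω
    obtain ⟨j, hj⟩ := hω
    rw [Classical.not_imp] at hj
    have h1 : j ≤ ⟨min (i - 1) (ℓ - 1), by omega⟩ := by
      rw [Fin.le_def]
      have := j.2
      have := hj.1
      simp only
      omega
    exact ⟨j, h1, fun h => hj.2 h.symm⟩
  have htime : expSum (predictive ch (treeEncode c)) (TreeStop c) N (fun s => ¬ TreeStop c s)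
      (fun _ => 1) ≤ T := by
    refine le_trans (le_of_eq ?_) (hT ▸ sum_measureReal_time_le htr hfin N)
    refine Finset.sum_congr rfl fun k _ => ?_
    rw [← stoppedExp_not_treeStop htr k]
    congr 1
    funext s
    by_cases hs : TreeStop c s <;> simp [hs]
  have hcard : ∀ (i : ℕ) (m : ∀ j, S j), ((@Finset.filter _ (fun m' => initial i m' = initial i m)
      (fun _ => Classical.propDecidable _) Finset.univ).card : ℝ) * initialCard S i
      = Fintype.card (∀ j, S j) := fun i m => by
    convert card_initial_mul i m
  obtain ⟨t, I, B, hA, htT, hsum, hinfo, hdiv⟩ :=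
    exists_phases (treeEncode c) (treeDecode c) (fun i => initial (S := S) i) hδ (by linarith)
      (fun m m' => initial_eq_iff.2 fun j hj => absurd hj (Nat.not_lt_zero _))
      (fun i m m' h => initial_eq_iff.2 fun j hj => initial_eq_iff.1 h j (by omega))
      (initialCard S) one_le_initialCard hcard
      (fun i hi => by nlinarith [two_le_initialCard hℓ hS hi])
      not_treeStop_nil hPe hPe0 hp e (fun i => subErrProb_pos htr hℓ hS _) hei htime
      (show 0 < ε by linarith) hε2 (by linarith) ℓ
  refine ⟨t, I, B, hA, htT, hsum, hinfo, fun i => ?_⟩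
  have hi : e (i.val + 1) = c.subErrProb P msg out i := by
    simp only [he]
    congr 1
    ext
    have := i.2
    simp only
    omega
  rw [← hi]
  exact hdiv (i.val + 1) (by omega) (by omega)

/-- The bounds in terms of the expected duration, information and divergence of the phases, for the
unlimited horizon. Compactness provides a limit of the phases for finite horizons. -/
lemma exists_phases_of_transmission (htr : IsTransmission ch c P msg out) (hℓ : 0 < ℓ)
    (hS : 2 ≤ Fintype.card (S ⟨0, hℓ⟩)) (hfin : c.expTime P out ≠ ⊤) {δ ε : ℝ} (hδ : 0 < δ)
    (hε : c.errProb P msg out + δ + c.errProb P msg out / δ = ε) (hε5 : ε ≤ 1 / 5) :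
    ∃ t I B : ℕ → ℝ, (∀ j, Achievable ch (t j) (I j) (B j)) ∧ (∀ j, 0 ≤ B j) ∧
      ∑ j ∈ Finset.range ℓ, t j ≤ (c.expTime P out).toReal ∧
      (∀ i, 0 < i → i ≤ ℓ → (1 - ε) * ∑ j ∈ Finset.range i, logCard S j - Real.binEntropy ε
        ≤ ∑ j ∈ Finset.range i, I j) ∧
      (∀ i : Fin ℓ, (1 - ε) * -Real.log (c.subErrProb P msg out i)
          - (Real.binEntropy ε - Real.log (ch.minProb * δ)) ≤
        ((c.expTime P out).toReal - ∑ j ∈ Finset.range ℓ, t j) * ch.maxDiv +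
          ∑ j ∈ Finset.range ℓ, (if i.val + 1 ≤ j then B j else 0)) := by
  set T := (c.expTime P out).toReal with hT
  have hPe0 : 0 ≤ c.errProb P msg out := measureReal_nonneg
  have hPeδ : 0 ≤ c.errProb P msg out / δ := div_nonneg hPe0 hδ.le
  -- As `ε ≤ 1 / 5`, this keeps the error parameter of the horizon `N` at most `1 / 2`.
  obtain ⟨N₀, hN₀⟩ : ∃ N₀ : ℕ, ∀ N, N₀ ≤ N → T / (N : ℝ) ≤ 3 / 10 :=
    eventually_atTop.1 ((tendsto_const_div_atTop_nhds_zero_nat T).eventually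
      (Iic_mem_nhds (show (0 : ℝ) < 3 / 10 by norm_num)))
  have key := fun n : ℕ => exists_phases_of_horizon htr hℓ hS hfin hδ hT
    (N := n + N₀ + 1) (by omega) rfl
    (by have := hN₀ (n + N₀ + 1) (by omega); linarith) (by linarith)
  simp only [hε] at key
  choose t I B hA htT hsum hinfo hdiv using key
  obtain ⟨t₀, I₀, B₀, I', B', ns, hns, hA₀, hB₀, hI', hB', lt, lI, lB⟩ :=
    exists_subseq_achievable t I B hA htT
  have lε : Tendsto (fun n => ε + T / (ns n + N₀ + 1 : ℕ)) atTop (𝓝 ε) := by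
    have h1 : Tendsto (fun n => ns n + N₀ + 1) atTop atTop := by
      refine tendsto_atTop_mono (fun n => ?_) hns.tendsto_atTop
      omega
    have := ((tendsto_const_div_atTop_nhds_zero_nat T).comp h1).const_add ε
    rw [add_zero] at this
    exact this
  have lh : Tendsto (fun n => Real.binEntropy (ε + T / (ns n + N₀ + 1 : ℕ))) atTop
      (𝓝 (Real.binEntropy ε)) := (Real.binEntropy_continuous.tendsto ε).comp lε
  have lsum : Tendsto (fun n => ∑ j ∈ Finset.range ℓ, t (ns n) j) atTop
      (𝓝 (∑ j ∈ Finset.range ℓ, t₀ j)) := tendsto_finsetSum _ fun j _ => lt j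
  refine ⟨t₀, I₀, B₀, hA₀, hB₀, le_of_tendsto' lsum fun n => hsum _, fun i hi hiℓ => ?_,
    fun i => ?_⟩
  · rw [← log_initialCard hiℓ]
    exact le_of_tendsto_of_tendsto' (((lε.const_sub 1).mul_const _).sub lh)
      (tendsto_finsetSum _ fun j _ => lI j)
      fun n => (hinfo (ns n) i hi).trans (Finset.sum_le_sum fun j _ => hI' n j)
  · have lB' : Tendsto (fun n => ∑ j ∈ Finset.range ℓ, if i.val + 1 ≤ j then B' n j else 0) atTop
        (𝓝 (∑ j ∈ Finset.range ℓ, if i.val + 1 ≤ j then B₀ j else 0)) :=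
      tendsto_finsetSum _ fun j _ => by
        split_ifs
        exacts [lB j, tendsto_const_nhds]
    refine le_of_tendsto_of_tendsto' (((lε.const_sub 1).mul_const _).sub (lh.sub_const _))
      (((lsum.const_sub T).mul_const ch.maxDiv).add lB') fun n => (hdiv (ns n) i).trans ?_
    refine add_le_add le_rfl (Finset.sum_le_sum fun j _ => ?_)
    split_ifs
    exacts [hB' n j, le_rfl]

end Final

end FeedbackUEP

end

open FeedbackUEP in
theorem lemma8 {X Y : Type*} [Fintype X] [Fintype Y] (ch : FeedbackUEP.Channel X Y)
    (ℓ : ℕ) (hℓ : 0 < ℓ) (S : Fin ℓ → Type*) [∀ i, Fintype (S i)] [∀ i, Nonempty (S i)]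
    (hS : 2 ≤ Fintype.card (S ⟨0, hℓ⟩))
    (c : FeedbackUEP.Code (∀ i, S i) X Y)
    {Ω : Type*} [MeasurableSpace Ω] (P : MeasureTheory.Measure Ω)
    [MeasureTheory.IsProbabilityMeasure P]
    (msg : Ω → ∀ i, S i) (out : ℕ → Ω → Y)
    (htr : FeedbackUEP.IsTransmission ch c P msg out)
    (δ Pe ε₃ ε₄ ε₅ : ℝ) (hδ : 0 < δ)
    (hPe : Pe = c.errProb P msg out)
    (hε₃ : ε₃ = Pe + δ + Pe / δ)
    (hε₄ : ε₄ = c.perUse P out (Real.binEntropy ε₃))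
    (hε₅ : ε₅ = c.perUse P out (Real.binEntropy ε₃ - Real.log (ch.minProb * δ)))
    (hsmall : Pe + δ + Pe / δ ≤ 1 / 5) :
    (∀ i, 0 < c.subErrProb P msg out i) ∧
    ∃ η : Fin ℓ → ℝ,
      (∀ i, (1 - ε₃) * c.subExponent P msg out i - ε₅ ≤
        (1 - ∑ j, η j) * ch.maxDiv +
          ∑ j ∈ Finset.Ioi i, η j * ch.J ((1 - ε₃) * c.subRate P out j / η j)) ∧
      (∀ i, (1 - ε₃) * c.subRate P out i - (if i = ⟨0, hℓ⟩ then ε₄ else 0) ≤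
        ch.capacity * η i) ∧
      (∀ i, 0 ≤ η i) ∧
      ∑ j, η j ≤ 1 := by
  refine ⟨subErrProb_pos htr hℓ hS, ?_⟩
  have : Nonempty X := ⟨c.encode (Classical.arbitrary _) 0 (fun k => k.elim0)⟩
  rcases eq_or_ne (c.expTime P out) ⊤ with htop | hfin
  · -- All rates, exponents and corrections vanish if the expected decoding time is infinite.
    refine ⟨fun _ => 0, fun i => ?_, fun i => ?_, fun i => le_rfl, by simp⟩
    · simpa [Code.subExponent, hε₅, Code.perUse, htop] using ch.maxDiv_nonneg
    · simp [Code.subRate, hε₄, Code.perUse, htop]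
  have hT1 : 1 ≤ c.expTime P out := by
    calc (1 : ENNReal) = ∫⁻ _, 1 ∂P := by simp
      _ ≤ _ := by
        refine lintegral_mono fun ω => ?_
        exact ENat.toENNReal_one.symm.trans_le
          (ENat.toENNReal_le.2 (c.one_le_time fun k => out k ω))
  set T := (c.expTime P out).toReal with hT
  have hT0 : 0 < T := ENNReal.toReal_pos (by positivity) hfin
  have hper : ∀ a, c.perUse P out a = a / T := fun a => by
    rw [Code.perUse, ENNReal.toReal_inv, div_eq_mul_inv]
  have hPe0 : 0 ≤ Pe := hPe ▸ measureReal_nonneg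
  have hε0 : 0 < ε₃ := by
    have := div_nonneg hPe0 hδ.le
    linarith
  have hε5 : ε₃ ≤ 1 / 5 := hε₃ ▸ hsmall
  obtain ⟨t, I, B, hA, hB, hsum, hinfo, hdiv⟩ :=
    exists_phases_of_transmission htr hℓ hS hfin hδ (by rw [← hPe, ← hε₃]) hε5
  -- Only the first phase may fall short of its information by the loss `h(ε₃)`.
  set r : ℕ → ℝ := fun j => (1 - ε₃) * logCard S j - if j = 0 then Real.binEntropy ε₃ else 0
    with hr
  have hr0 : ∀ j, 0 ≤ r j := by
    intro j
    simp only [hr]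
    split_ifs with hj
    · rw [hj, logCard, dif_pos hℓ, sub_nonneg]
      exact binEntropy_le_one_sub_mul_log hε0 hε5 (by exact_mod_cast hS)
    · rw [sub_zero]
      exact mul_nonneg (by linarith) (logCard_nonneg j)
  obtain ⟨t', I', B', hA', hI', ht', hB'⟩ := exists_redistribution ℓ t I B r hA hB hr0 (by
    intro i hi
    rcases Nat.eq_zero_or_pos i with rfl | hi0
    · simp
    · refine le_trans (le_of_eq ?_) (hinfo i hi0 hi)
      simp only [hr, Finset.sum_sub_distrib, ← Finset.mul_sum, Finset.sum_ite_eq',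
        Finset.mem_range, hi0, if_true])
  have hηsum : ∑ j : Fin ℓ, t' j / T = (∑ j ∈ Finset.range ℓ, t j) / T := by
    rw [← Finset.sum_div, ← ht', Finset.sum_range]
  have hlog : ∀ j : Fin ℓ, logCard S j = Real.log (Fintype.card (S j)) := fun j => dif_pos j.2
  refine ⟨fun j => t' j / T, fun i => ?_, fun i => ?_, fun i => ?_, ?_⟩
  · rw [hηsum, Code.subExponent, hper, hε₅, hper]
    have h1 : ∑ j ∈ Finset.range ℓ, (if i.val + 1 ≤ j then B' j else 0)
        = ∑ j ∈ Finset.Ioi i, B' j := by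
      rw [Finset.sum_range, ← Finset.sum_filter]
      congr 1
      ext j
      rw [Finset.mem_filter, Finset.mem_Ioi, Fin.lt_def]
      simp
    have h2 := (hdiv i).trans (add_le_add le_rfl ((hB' (i.val + 1)).trans_eq h1))
    have h3 : ∀ j ∈ Finset.Ioi i,
        B' j / T ≤ t' j / T * ch.J ((1 - ε₃) * c.subRate P out j / (t' j / T)) := by
      intro j hj
      have hj0 : j.val ≠ 0 := by
        have := Fin.lt_def.1 (Finset.mem_Ioi.1 hj)
        omega
      have hrj : r j = (1 - ε₃) * Real.log (Fintype.card (S j)) := by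
        simp only [hr, hj0, if_false, sub_zero, hlog]
      rw [Code.subRate, hper, div_mul_eq_mul_div]
      gcongr
      rcases eq_or_lt_of_le (hA' j).time_nonneg with hz | hz
      · have := hA' j
        rw [← hz] at this ⊢
        simpa using this.div_nonpos
      · refine ((hA' j).div_le_J hz (hI' j j.2)).trans_eq ?_
        rw [hrj]
        congr 2
        field_simp
    calc _ = ((1 - ε₃) * -Real.log (c.subErrProb P msg out i)
          - (Real.binEntropy ε₃ - Real.log (ch.minProb * δ))) / T := by ring
      _ ≤ ((T - ∑ j ∈ Finset.range ℓ, t j) * ch.maxDiv + ∑ j ∈ Finset.Ioi i, B' j) / T := by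
          gcongr
      _ = (1 - (∑ j ∈ Finset.range ℓ, t j) / T) * ch.maxDiv
          + ∑ j ∈ Finset.Ioi i, B' j / T := by
          rw [← Finset.sum_div]
          field_simp
      _ ≤ _ := add_le_add le_rfl (Finset.sum_le_sum h3)
  · rw [Code.subRate, hper, hε₄, hper, ← mul_div_assoc ch.capacity]
    have h1 : (1 - ε₃) * (Real.log (Fintype.card (S i)) / T)
        - (if i = ⟨0, hℓ⟩ then Real.binEntropy ε₃ / T else 0) = r i / T := by
      simp only [hr, hlog, Fin.ext_iff]
      split_ifs <;> ring
    rw [h1]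
    exact div_le_div_of_nonneg_right ((hI' i i.2).trans (hA' i).info_le) hT0.le
  · exact div_nonneg (hA' i).time_nonneg hT0.le
  · rw [hηsum]
    exact (div_le_one hT0).2 hsum
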